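/- **Setting.** Fix $L>0$, $H,U\in\mathbb R$, a noise variance $s\ge 0$, and integers $N\ge 1$, $A\ge 1$ with $N\ge 8H/L$. Let $T\ge T_1:=AN$ and let $u^1,\dots,u^T:[0,1]\to\mathbb R$ be utility functions that are $L$-Lipschitz, twice continuously differentiable with $|(u^t)''|\le H$, and bounded by $|u^t|\le U$. (For instance, $u^t$ may be the utility of a fog node for one task, $u^t(x)=\rho(1-e^{-x/(\rho(x+X^t))})+\epsilon(x+X^t)-\kappa x$, where $X^t>0$ is the total request of the other nodes.) After choosing $x^t\in[0,1]$ in round $t$ the agent observes only $r^t=u^t(x^t)+g^t$, where the $g^t$ are independent centred Gaussian variables of variance $s$. **The policy (Lipschitz bandit with initialization).** For weights $w\in(0,\infty)^K$ put $p_{\gamma,w}[n]=(1-\gamma)\,w[n]/\sum_{i<K} w[i]+\gamma/K$, $0\le n<K$. The EXP3 update after playing arm $n$ and observing $r$ multiplies $w[n]$ by $\exp\!\big(\gamma r/(K\,p_{\gamma,w}[n])\big)$ and leaves the other weights unchanged. *Phase I* (rounds $1,\dots,T_1$). The arms $0,\dots,N-1$ are pulled in a random order, of any law, in which each arm occurs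 exactly $A$ times. When arm $n$ is pulled, the action is drawn uniformly from $[\frac nN,\frac{n+1}N]$. The weights $\Omega^1\equiv1,\Omega^2,\dots$ are updated by the EXP3 update with $K=N$ and some $\gamma\in(0,1]$. With $\hat\mu[n]$ the average observation of arm $n$, put $$\hat L=N\max_{0\le n<N-1}|\hat\mu[n]-\hat\mu[n+1]|\ (\hat L=0 \text{ if } N=1),\qquad \tilde L=\hat L+N\sqrt{\tfrac2A\ln(2NT)},\qquad \tilde N=N\Big\lceil \tfrac{\tilde L^{2/3}T^{1/3}}{N}\Big\rceil .$$ *Phase II* (rounds $T_1+1,\dots,T$). EXP3 is run on the $\tilde N$ intervals $[\frac n{\tilde N},\frac{n+1}{\tilde N}]$ with $\tilde\gamma=\min\{1,\sqrt{\tilde N\ln\tilde N/((e-1)T)}\}$ and initial weights $\omega^{T_1+1}[n]=\frac N{\tilde N}\,\Omega^{T_1}\big[\lfloor nN/\tilde N\rfloor\big]$. In each round an arm is drawn from $p_{\tilde\gamma,\omega^t}$, the action is drawn uniformly from its interval, and the weights are updated by the EXP3 update with $K=\tilde N$ and $\tilde\gamma$. The exploration order, the noise and all other random draws are independent. **Proposition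 7.** There are constants $C$ and $k$, depending only on $L,H,U,s,N,A$, such that for all $T$, $u^1,\dots,u^T$, $\gamma$ and exploration orders as above the following holds. With probability at least $1-\frac1T$ over Phase I, the conditional expectation, given Phase I, of the regret $R(T)=\max_{x\in[0,1]}\sum_{t=1}^Tu^t(x)-\sum_{t=1}^Tu^t(x^t)$ of the whole run satisfies $$\mathbb E[R(T)\mid \text{Phase I}]\le C\,T^{5/6}(\ln T)^k,$$ that is, it is $\tilde{\mathcal O}(T^{5/6})$. If moreover $u^1=\dots=u^T$ on $[0,1]$, the same bound holds for $\sum_{t=1}^T\mathbb E\big[\max_{x\in[0,1]}u^t(x)-u^t(x^t)\mid\text{Phase I}\big]$. -/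

import Mathlib

open MeasureTheory ProbabilityTheory Set
open scoped NNReal

noncomputable section

namespace LipschitzBandit

/-- A utility function on the action space `[0,1]`: it is `L`-Lipschitz, twice continuously
differentiable with second derivative bounded by `H` (one-sided derivatives at the end points),
and its absolute value is at most `U`. -/
structure IsUtility (L H U : ℝ) (u : ℝ → ℝ) : Prop where
  lipschitz : ∀ x ∈ Icc (0 : ℝ) 1, ∀ y ∈ Icc (0 : ℝ) 1, |u x - u y| ≤ L * |x - y|
  contDiffOn : ContDiffOn ℝ 2 u (Icc 0 1)
  hessian : ∀ x ∈ Icc (0 : ℝ) 1, |iteratedDerivWithin 2 u (Icc 0 1) x| ≤ H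
  bounded : ∀ x ∈ Icc (0 : ℝ) 1, |u x| ≤ U

/-! ### EXP3 on `K` arms `0, …, K - 1` -/

/-- The EXP3 probability of arm `n` for the weight vector `w`. -/
def exp3Prob (γ : ℝ) (K : ℕ) (w : ℕ → ℝ) (n : ℕ) : ℝ :=
  (1 - γ) * (w n / ∑ i ∈ Finset.range K, w i) + γ / K

/-- The EXP3 weight vector after arm `n` has been played and the reward `r` observed. -/
def exp3Update (γ : ℝ) (K : ℕ) (w : ℕ → ℝ) (n : ℕ) (r : ℝ) : ℕ → ℝ :=
  Function.update w n (w n * Real.exp (γ * r / (K * exp3Prob γ K w n)))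

/-- Drawing one of the arms `0, …, K - 1` from the probability vector `p` by inversion of the
cumulative distribution function, given a uniform seed `v`. The number of `n` with
`p 0 + … + p n ≤ v` is the selected arm; the minimum matters only for `v = 1`. -/
def sampleArm (K : ℕ) (p : ℕ → ℝ) (v : unitInterval) : ℕ :=
  min (K - 1)
    ((Finset.range K).filter fun n => ∑ i ∈ Finset.range (n + 1), p i ≤ (v : ℝ)).card

/-- The uniform sample from `[n / K, (n + 1) / K]`, given a uniform seed `y`. -/
def samplePoint (K n : ℕ) (y : unitInterval) : ℝ := ((n : ℝ) + (y : ℝ)) / K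

/-! ### The policy

Rounds are numbered from `0` to `T - 1`; the utility function of round `t` is `u t`. -/

/-- Parameters: `N` intervals in Phase I, each explored `A` times, horizon `T`, and the EXP3
constant `γ` used for the weights that are recorded during Phase I. -/
structure Params where
  N : ℕ
  A : ℕ
  T : ℕ
  γ : ℝ

/-- The randomness of Phase I: the arm pulled in each round; the uniform seed of the action within
the interval and the additive noise of each round. -/
abbrev ExploreSample : Type := (ℕ → ℕ) × (ℕ → unitInterval × ℝ)

/-- The randomness of Phase II: for each round, the uniform seed of the arm, the uniform seed of
the action within the interval, and the additive noise. -/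
abbrev ExploitSample : Type := ℕ → unitInterval × unitInterval × ℝ

namespace Params

/-- The length of Phase I. -/
def T₁ (P : Params) : ℕ := P.A * P.N

/-! #### Phase I: pure exploration -/

def exploreAction (P : Params) (ω : ExploreSample) (t : ℕ) : ℝ :=
  samplePoint P.N (ω.1 t) (ω.2 t).1

/-- The observed noisy utility. -/
def exploreReward (P : Params) (u : ℕ → ℝ → ℝ) (ω : ExploreSample) (t : ℕ) : ℝ :=
  u t (P.exploreAction ω t) + (ω.2 t).2

/-- The average observed utility of arm `n` at the end of Phase I. -/
def exploreMean (P : Params) (u : ℕ → ℝ → ℝ) (ω : ExploreSample) (n : ℕ) : ℝ :=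
  (∑ t ∈ (Finset.range P.T₁).filter (fun t => ω.1 t = n), P.exploreReward u ω t) /
    (((Finset.range P.T₁).filter fun t => ω.1 t = n).card : ℝ)

/-- The weight vector recorded in Phase I, before round `t`. -/
def exploreWeight (P : Params) (u : ℕ → ℝ → ℝ) (ω : ExploreSample) : ℕ → ℕ → ℝ
  | 0 => fun _ => 1
  | t + 1 => exp3Update P.γ P.N (P.exploreWeight u ω t) (ω.1 t) (P.exploreReward u ω t)

/-- `N` times the largest difference of the averages of two adjacent arms
(the supremum over the empty set, for `N = 1`, is `0`). -/
def lipHat (P : Params) (u : ℕ → ℝ → ℝ) (ω : ExploreSample) : ℝ :=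
  P.N * ⨆ n : Fin (P.N - 1), |P.exploreMean u ω n - P.exploreMean u ω (n + 1)|

/-- The estimate of the Lipschitz constant. -/
def lipTilde (P : Params) (u : ℕ → ℝ → ℝ) (ω : ExploreSample) : ℝ :=
  P.lipHat u ω + P.N * Real.sqrt (2 / P.A * Real.log (2 * P.N * P.T))

/-- The number of intervals of Phase II. -/
def numArms (P : Params) (u : ℕ → ℝ → ℝ) (ω : ExploreSample) : ℕ :=
  P.N * ⌈P.lipTilde u ω ^ (2 / 3 : ℝ) * (P.T : ℝ) ^ (1 / 3 : ℝ) / P.N⌉₊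

/-! #### Phase II: EXP3 -/

/-- The tuning of EXP3 for `K` arms and horizon `T` (Auer, Cesa-Bianchi, Freund, Schapire). -/
def exploitGamma (P : Params) (K : ℕ) : ℝ :=
  min 1 (Real.sqrt (K * Real.log K / ((Real.exp 1 - 1) * P.T)))

/-- The initial weights of Phase II: interval `n` of Phase II inherits the weight of the interval
of Phase I that contains it, which is the one with index `⌊n N / numArms⌋`. The weights of Phase I
are those used in its last round. -/
def initWeight (P : Params) (u : ℕ → ℝ → ℝ) (ω : ExploreSample) (n : ℕ) : ℝ :=
  (P.N : ℝ) / P.numArms u ω * P.exploreWeight u ω (P.T₁ - 1) (n * P.N / P.numArms u ω)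

/-- The arm played for the current weights `w` and the seed `v`. -/
def exploitArm (P : Params) (u : ℕ → ℝ → ℝ) (ω : ExploreSample) (w : ℕ → ℝ)
    (v : unitInterval) : ℕ :=
  sampleArm (P.numArms u ω) (exp3Prob (P.exploitGamma (P.numArms u ω)) (P.numArms u ω) w) v

/-- The weight vector before round `j` of Phase II (which is round `T₁ + j` of the run). -/
def exploitWeight (P : Params) (u : ℕ → ℝ → ℝ) (ω : ExploreSample) (η : ExploitSample) :
    ℕ → ℕ → ℝ
  | 0 => P.initWeight u ω
  | j + 1 =>
    let w := P.exploitWeight u ω η j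
    let n := P.exploitArm u ω w (η j).1
    let x := samplePoint (P.numArms u ω) n (η j).2.1
    exp3Update (P.exploitGamma (P.numArms u ω)) (P.numArms u ω) w n
      (u (P.T₁ + j) x + (η j).2.2)

/-- The action of round `j` of Phase II. -/
def exploitAction (P : Params) (u : ℕ → ℝ → ℝ) (ω : ExploreSample) (η : ExploitSample)
    (j : ℕ) : ℝ :=
  samplePoint (P.numArms u ω) (P.exploitArm u ω (P.exploitWeight u ω η j) (η j).1) (η j).2.1

/-! #### The whole run -/

/-- The action of round `t`. -/
def action (P : Params) (u : ℕ → ℝ → ℝ) (ω : ExploreSample) (η : ExploitSample) (t : ℕ) : ℝ :=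
  if t < P.T₁ then P.exploreAction ω t else P.exploitAction u ω η (t - P.T₁)

/-- Regret of the run against the best fixed action in hindsight. -/
def externalRegret (P : Params) (u : ℕ → ℝ → ℝ) (ω : ExploreSample) (η : ExploitSample) : ℝ :=
  (⨆ x : unitInterval, ∑ t ∈ Finset.range P.T, u t x) -
    ∑ t ∈ Finset.range P.T, u t (P.action u ω η t)

/-- Sum over the rounds of the differences between the best and the achieved utility. -/
def cumulativeRegret (P : Params) (u : ℕ → ℝ → ℝ) (ω : ExploreSample) (η : ExploitSample) : ℝ :=
  ∑ t ∈ Finset.range P.T, ((⨆ x : unitInterval, u t x) - u t (P.action u ω η t))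

end Params

/-- `ν` is the law of a random order of exploration in which, in the first `A * N` rounds, each of
the arms `0, …, N - 1` is pulled exactly `A` times (such as a uniformly random order). -/
def IsUniformExploration (N A : ℕ) (ν : Measure (ℕ → ℕ)) : Prop :=
  IsProbabilityMeasure ν ∧
    ∀ᵐ a ∂ν, ∀ n < N, ((Finset.range (A * N)).filter fun t => a t = n).card = A

/-- The law of the randomness of Phase I: the order of exploration, the uniform seeds and the
centred Gaussian noises with variance `s` are independent. -/
def exploreLaw (ν : Measure (ℕ → ℕ)) (s : ℝ≥0) : Measure ExploreSample :=
  ν.prod (Measure.infinitePi fun _ : ℕ =>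
    (volume : Measure unitInterval).prod (gaussianReal 0 s))

/-- The law of the randomness of Phase II, which is independent of that of Phase I. -/
def exploitLaw (s : ℝ≥0) : Measure ExploitSample :=
  Measure.infinitePi fun _ : ℕ =>
    (volume : Measure unitInterval).prod
      ((volume : Measure unitInterval).prod (gaussianReal 0 s))

end LipschitzBandit

end

/-! Phase I has the fixed length `A * N`, so it can only do bounded harm. By a Chernoff and a union
bound, with probability at least `1 - 1/T` all its noises are at most `B = O(log T)` in absolute
value. On that event every recorded log-weight is at most `T₁ * (U + B)` in absolute value. Hence
each arm of Phase II starts with a share of at least `exp (-2 * T₁ * (U + B)) / K`, where `K` is the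
number of arms, and the inherited weights cost EXP3 only a logarithmic term. On the same event the
estimate `lipTilde` lies between a positive constant (its confidence term) and a multiple of `log
T`, so `K` is of order `T ^ (1/3)` up to logarithms. The accuracy of the estimate plays no role.

Phase II is EXP3 with arbitrary positive initial weights and unbounded Gaussian noise
(`exp3_regret`). The potential is the log-share of a comparison arm `j`. Since uniform exploration
keeps the rate `γ / (K * p)` at most `1`, the exponential moment of a noisy reward is `1 + a * m +
O(a ^ 2)`. The expected one-round drift of the potential is therefore at least `γ / K` times (mean
of `j` minus expected played reward minus `O(γ)`); see `exp3Step_drift`. Telescoping, with the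
potential never positive, bounds the regret by `K / γ * (-log of the initial share) + O(γ * T)`.
Comparing a point with its cell costs a further `L * T / K`.

With `x = T ^ (1/24)` and each logarithm bounded by a multiple of `x ^ 2`, one has `K / γ = O(x ^
17)`, so the terms are `O(x ^ 19)`, `O(x ^ 18)` and `O(x ^ 16)`, all below `x ^ 20 = T ^ (5/6)`. If
`K = 1` or `γ > 1/2`, the horizon itself is `O(x ^ 20)` and the trivial bound `2 * U * T` suffices.
-/

noncomputable section

namespace LipschitzBandit

/-! ### Processes driven by independent inputs -/

/-- A function of the inputs before time `j` and the input at time `j` have as joint law the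
product of their laws. -/
lemma map_prodMk_eval_infinitePi {Z S : Type*} [MeasurableSpace Z] [MeasurableSpace S] [Nonempty Z]
    (ρ : Measure Z) [IsProbabilityMeasure ρ] {X : (ℕ → Z) → S} (hX : Measurable X) (j : ℕ)
    (hdep : ∀ η η' : ℕ → Z, (∀ i < j, η i = η' i) → X η = X η') :
    (Measure.infinitePi fun _ : ℕ => ρ).map (fun η => (X η, η j)) =
      ((Measure.infinitePi fun _ : ℕ => ρ).map X).prod ρ := by
  classical
  have hind : iIndepFun (fun (i : ℕ) (η : ℕ → Z) => η i) (Measure.infinitePi fun _ : ℕ => ρ) :=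
    iIndepFun_infinitePi (P := fun _ : ℕ => ρ) (X := fun _ z => z) (fun _ => measurable_id)
  have h2 := hind.indepFun_finset (Finset.range j) {j} (by simp) (fun i => measurable_pi_apply i)
  -- Inputs from time `j` on are replaced by a fixed value. By `hdep` this does not change `X`, so
  -- `X` factors through the first `j` inputs.
  let ext : ((Finset.range j) → Z) → ℕ → Z := fun a i =>
    if h : i ∈ Finset.range j then a ⟨i, h⟩ else Classical.arbitrary Z
  have hext : Measurable ext := by
    refine measurable_pi_lambda _ fun i => ?_
    by_cases h : i ∈ Finset.range j
    · simp only [ext, h, dite_true]; exact measurable_pi_apply _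
    · simp only [ext, h, dite_false]; exact measurable_const
  have h3 : IndepFun X (fun η : ℕ → Z => η j) (Measure.infinitePi fun _ : ℕ => ρ) := by
    have hproj : Measurable fun b : (({j} : Finset ℕ) → Z) => b ⟨j, by simp⟩ :=
      measurable_pi_apply _
    have h4 := h2.comp (φ := fun a => X (ext a))
      (ψ := fun b : (({j} : Finset ℕ) → Z) => b ⟨j, by simp⟩)
      (hX.comp hext) hproj
    have h5 : (fun a => X (ext a)) ∘ (fun (η : ℕ → Z) (i : Finset.range j) => η i) = X := by
      funext η
      refine hdep _ _ fun i hi => ?_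
      simp [ext, hi]
    rw [h5] at h4
    exact h4
  rw [(indepFun_iff_map_prod_eq_prod_map_map hX.aemeasurable
    (measurable_pi_apply j).aemeasurable).1 h3]
  congr 1
  exact Measure.infinitePi_map_eval (fun _ : ℕ => ρ) j

/-- A lower bound for the conditional expectation given the inputs before time `j` is a lower bound
for the expectation. -/
lemma le_integral_eval_infinitePi {Z S : Type*} [MeasurableSpace Z] [MeasurableSpace S]
    [Nonempty Z] (ρ : Measure Z) [IsProbabilityMeasure ρ] {X : (ℕ → Z) → S} (hX : Measurable X)
    (j : ℕ) (hdep : ∀ η η' : ℕ → Z, (∀ i < j, η i = η' i) → X η = X η')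
    {G : S × Z → ℝ} (hG : Measurable G) {c : ℝ}
    (hInt : Integrable (fun η => G (X η, η j)) (Measure.infinitePi fun _ : ℕ => ρ))
    (hle : ∀ η, c ≤ ∫ z, G (X η, z) ∂ρ) :
    c ≤ ∫ η, G (X η, η j) ∂(Measure.infinitePi fun _ : ℕ => ρ) := by
  have hm : Measurable fun η : ℕ → Z => (X η, η j) := hX.prodMk (measurable_pi_apply j)
  have hmap := map_prodMk_eval_infinitePi ρ hX j hdep
  have hInt' : Integrable G (((Measure.infinitePi fun _ : ℕ => ρ).map X).prod ρ) := by
    rw [← hmap]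
    exact (integrable_map_measure hG.aestronglyMeasurable hm.aemeasurable).2 hInt
  have hP : IsProbabilityMeasure ((Measure.infinitePi fun _ : ℕ => ρ).map X) :=
    Measure.isProbabilityMeasure_map hX.aemeasurable
  have h1 : ∫ η, G (X η, η j) ∂(Measure.infinitePi fun _ : ℕ => ρ) =
      ∫ p, G p ∂(((Measure.infinitePi fun _ : ℕ => ρ).map X).prod ρ) := by
    rw [← hmap, integral_map hm.aemeasurable hG.aestronglyMeasurable]
  have hsm : AEStronglyMeasurable (fun x => ∫ z, G (x, z) ∂ρ)
      ((Measure.infinitePi fun _ : ℕ => ρ).map X) := hInt'.integral_prod_left.aestronglyMeasurable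
  have hInt'' := (integrable_map_measure hsm hX.aemeasurable).1 hInt'.integral_prod_left
  rw [h1, integral_prod _ hInt', integral_map hX.aemeasurable hsm]
  have h2 := integral_mono (integrable_const c) hInt'' hle
  simpa using h2

/-! ### Sampling an arm -/

lemma sampleArm_lt {K : ℕ} (hK : 1 ≤ K) (p : ℕ → ℝ) (v : unitInterval) : sampleArm K p v < K := by
  unfold sampleArm
  omega

/-- Nonnegativity makes the partial sums monotone, so the indices counted by `sampleArm` are exactly
those below `i`. -/
lemma sampleArm_eq {K : ℕ} {p : ℕ → ℝ} (hp : ∀ i, 0 ≤ p i) {i : ℕ} (hi : i < K) {v : unitInterval}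
    (h1 : ∑ n ∈ Finset.range i, p n ≤ v) (h2 : (v : ℝ) < ∑ n ∈ Finset.range (i + 1), p n) :
    sampleArm K p v = i := by
  have hmono : Monotone fun n => ∑ i ∈ Finset.range n, p i := by
    refine monotone_nat_of_le_succ fun n => ?_
    rw [Finset.sum_range_succ]
    linarith [hp n]
  have hset : ((Finset.range K).filter fun n => ∑ i ∈ Finset.range (n + 1), p i ≤ (v : ℝ)) =
      Finset.range i := by
    ext n
    simp only [Finset.mem_filter, Finset.mem_range]
    constructor
    · rintro ⟨-, hn⟩
      by_contra! hin
      have := hmono (Nat.succ_le_succ hin)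
      simp only [Nat.succ_eq_add_one] at this
      linarith
    · intro hn
      have := hmono (Nat.succ_le_of_lt hn)
      simp only [Nat.succ_eq_add_one] at this
      exact ⟨hn.trans hi, this.trans h1⟩
  unfold sampleArm
  rw [hset, Finset.card_range]
  omega

lemma measurable_sampleArm (K : ℕ) :
    Measurable fun q : (ℕ → ℝ) × unitInterval => sampleArm K q.1 q.2 := by
  have h : Measurable fun q : (ℕ → ℝ) × unitInterval =>
      ∑ n ∈ Finset.range K, if ∑ i ∈ Finset.range (n + 1), q.1 i ≤ (q.2 : ℝ) then 1 else 0 := by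
    refine Finset.measurable_sum _ fun n _ => ?_
    refine Measurable.ite (measurableSet_le ?_ ?_) measurable_const measurable_const
    · fun_prop
    · fun_prop
  have h' : (fun q : (ℕ → ℝ) × unitInterval => sampleArm K q.1 q.2) = fun q =>
      min (K - 1) (∑ n ∈ Finset.range K,
        if ∑ i ∈ Finset.range (n + 1), q.1 i ≤ (q.2 : ℝ) then 1 else 0) := by
    funext q
    rw [sampleArm, Finset.card_filter]
  rw [h']
  exact measurable_const.min h

lemma measurable_sampleArm_right (K : ℕ) (p : ℕ → ℝ) :
    Measurable fun v : unitInterval => sampleArm K p v := by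
  have h : Measurable fun v : unitInterval => (p, v) := measurable_prodMk_left
  have h2 := Measurable.comp (measurable_sampleArm K) h
  simpa only [Function.comp_def] using h2

/-- The arms are drawn with the prescribed probabilities. -/
lemma volume_sampleArm {K : ℕ} (hK : 1 ≤ K) {p : ℕ → ℝ} (hp : ∀ i, 0 ≤ p i)
    (hsum : ∑ i ∈ Finset.range K, p i = 1) {i : ℕ} (hi : i < K) :
    (volume : Measure unitInterval).real (sampleArm K p ⁻¹' {i}) = p i := by
  -- Only a lower bound is proved for each arm, from a half-open interval of seeds of length `p j`.
  -- Both families sum to `1`, so all the inequalities are equalities and the seed `v = 1` needs no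
  -- separate treatment.
  have hle : ∀ j < K, p j ≤ (volume : Measure unitInterval).real (sampleArm K p ⁻¹' {j}) := by
    intro j hj
    have hS0 : 0 ≤ ∑ n ∈ Finset.range j, p n := Finset.sum_nonneg fun _ _ => hp _
    have hS1 : ∑ n ∈ Finset.range (j + 1), p n ≤ 1 := by
      rw [← hsum]
      exact Finset.sum_le_sum_of_subset_of_nonneg
        (Finset.range_subset_range.2 hj) fun _ _ _ => hp _
    have hS : ∑ n ∈ Finset.range (j + 1), p n = ∑ n ∈ Finset.range j, p n + p j :=
      Finset.sum_range_succ _ _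
    have hsub : Ico (⟨∑ n ∈ Finset.range j, p n, hS0, by linarith [hp j]⟩ : unitInterval)
        ⟨∑ n ∈ Finset.range (j + 1), p n, by linarith [hp j], hS1⟩ ⊆ sampleArm K p ⁻¹' {j} :=
      fun v hv => sampleArm_eq hp hj hv.1 hv.2
    have := measureReal_mono (μ := (volume : Measure unitInterval)) hsub
    rw [measureReal_def, unitInterval.volume_Ico, ENNReal.toReal_ofReal] at this
    · simpa [hS] using this
    · simp [hS, hp j]
  have htot : ∑ j ∈ Finset.range K, (volume : Measure unitInterval).real (sampleArm K p ⁻¹' {j})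
      = 1 := by
    rw [← measureReal_biUnion_finset]
    · have : (⋃ b ∈ Finset.range K, sampleArm K p ⁻¹' {b}) = univ := by
        ext v
        simp [sampleArm_lt hK]
      rw [this]
      simp
    · intro a _ b _ hab
      exact Disjoint.preimage _ (by simpa using hab)
    · intro b _
      exact measurable_sampleArm_right K p (measurableSet_singleton b)
  have h0 : ∑ j ∈ Finset.range K,
      ((volume : Measure unitInterval).real (sampleArm K p ⁻¹' {j}) - p j) = 0 := by
    rw [Finset.sum_sub_distrib, htot, hsum, sub_self]
  have := (Finset.sum_eq_zero_iff_of_nonneg fun j hj =>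
    sub_nonneg.2 (hle j (Finset.mem_range.1 hj))).1 h0 i (Finset.mem_range.2 hi)
  linarith

/-- Expectation of a function of a sampled arm and of further independent randomness. -/
lemma integral_sampleArm {Y : Type*} [MeasurableSpace Y] (κ : Measure Y) [IsProbabilityMeasure κ]
    {K : ℕ} (hK : 1 ≤ K) {p : ℕ → ℝ} (hp : ∀ i, 0 ≤ p i) (hsum : ∑ i ∈ Finset.range K, p i = 1)
    {h : ℕ → Y → ℝ} (hh : ∀ i < K, Integrable (h i) κ) :
    ∫ z : unitInterval × Y, h (sampleArm K p z.1) z.2 ∂((volume : Measure unitInterval).prod κ) =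
      ∑ i ∈ Finset.range K, p i * ∫ y, h i y ∂κ := by
  have heq : (fun z : unitInterval × Y => h (sampleArm K p z.1) z.2) = fun z =>
      ∑ i ∈ Finset.range K, (sampleArm K p ⁻¹' {i}).indicator (fun _ => (1 : ℝ)) z.1 * h i z.2 := by
    funext z
    rw [Finset.sum_eq_single (sampleArm K p z.1)]
    · simp
    · intro b _ hb
      simp [indicator, hb.symm]
    · intro hn
      exact absurd (Finset.mem_range.2 (sampleArm_lt hK p z.1)) hn
  have hms : ∀ i, MeasurableSet (sampleArm K p ⁻¹' {i}) := fun i =>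
    measurable_sampleArm_right K p (measurableSet_singleton i)
  rw [heq, integral_finsetSum]
  · refine Finset.sum_congr rfl fun i hi => ?_
    rw [integral_prod_mul (fun v => (sampleArm K p ⁻¹' {i}).indicator (fun _ => (1 : ℝ)) v) (h i),
      integral_indicator_const _ (hms i), volume_sampleArm hK hp hsum (Finset.mem_range.1 hi)]
    simp
  · intro i hi
    exact Integrable.mul_prod ((integrable_const (1 : ℝ)).indicator (hms i))
      (hh i (Finset.mem_range.1 hi))

/-! ### EXP3 probabilities and updates -/

lemma sum_range_pos {K : ℕ} (hK : 1 ≤ K) {w : ℕ → ℝ} (hw : ∀ i, 0 < w i) :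
    0 < ∑ i ∈ Finset.range K, w i :=
  Finset.sum_pos (fun i _ => hw i) ⟨0, Finset.mem_range.2 hK⟩

lemma div_le_exp3Prob {γ : ℝ} (hγ1 : γ ≤ 1) {K : ℕ} {w : ℕ → ℝ} (hw : ∀ i, 0 < w i) (n : ℕ) :
    γ / K ≤ exp3Prob γ K w n := by
  have : 0 ≤ (1 - γ) * (w n / ∑ i ∈ Finset.range K, w i) :=
    mul_nonneg (by linarith) (div_nonneg (hw n).le (Finset.sum_nonneg fun i _ => (hw i).le))
  unfold exp3Prob
  linarith

lemma exp3Prob_pos {γ : ℝ} (hγ0 : 0 < γ) (hγ1 : γ ≤ 1) {K : ℕ} (hK : 1 ≤ K) {w : ℕ → ℝ}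
    (hw : ∀ i, 0 < w i) (n : ℕ) : 0 < exp3Prob γ K w n :=
  (div_pos hγ0 (by exact_mod_cast hK)).trans_le (div_le_exp3Prob hγ1 hw n)

lemma sum_exp3Prob (γ : ℝ) {K : ℕ} (hK : 1 ≤ K) {w : ℕ → ℝ} (hw : ∀ i, 0 < w i) :
    ∑ i ∈ Finset.range K, exp3Prob γ K w i = 1 := by
  have hW := (sum_range_pos hK hw).ne'
  have hK' : (K : ℝ) ≠ 0 := by positivity
  simp only [exp3Prob]
  rw [Finset.sum_add_distrib, ← Finset.mul_sum, ← Finset.sum_div, div_self hW]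
  simp only [Finset.sum_const, Finset.card_range, nsmul_eq_mul]
  field_simp
  ring

/-- The exponent by which the EXP3 update multiplies the reward. -/
def exp3Rate (γ : ℝ) (K : ℕ) (w : ℕ → ℝ) (n : ℕ) : ℝ := γ / (K * exp3Prob γ K w n)

lemma exp3Rate_nonneg {γ : ℝ} (hγ0 : 0 < γ) (hγ1 : γ ≤ 1) {K : ℕ} (hK : 1 ≤ K) {w : ℕ → ℝ}
    (hw : ∀ i, 0 < w i) (n : ℕ) : 0 ≤ exp3Rate γ K w n :=
  div_nonneg hγ0.le (mul_nonneg (Nat.cast_nonneg _) (exp3Prob_pos hγ0 hγ1 hK hw n).le)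

/-- The uniform exploration `γ / K` in the probability caps the importance weight. This is what
keeps exponential moments of unbounded rewards under control. -/
lemma exp3Rate_le_one {γ : ℝ} (hγ0 : 0 < γ) (hγ1 : γ ≤ 1) {K : ℕ} (hK : 1 ≤ K) {w : ℕ → ℝ}
    (hw : ∀ i, 0 < w i) (n : ℕ) : exp3Rate γ K w n ≤ 1 := by
  have hK' : (0 : ℝ) < K := by exact_mod_cast hK
  have hp := exp3Prob_pos hγ0 hγ1 hK hw n
  have h := div_le_exp3Prob hγ1 hw (K := K) n
  rw [exp3Rate, div_le_one (mul_pos hK' hp)]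
  rwa [div_le_iff₀' hK'] at h

/-- Unbiasedness of importance weighting: the chance of playing an arm cancels the factor in its
update. -/
lemma exp3Prob_mul_exp3Rate {γ : ℝ} (hγ0 : 0 < γ) (hγ1 : γ ≤ 1) {K : ℕ} (hK : 1 ≤ K) {w : ℕ → ℝ}
    (hw : ∀ i, 0 < w i) (n : ℕ) : exp3Prob γ K w n * exp3Rate γ K w n = γ / K := by
  have hp := (exp3Prob_pos hγ0 hγ1 hK hw n).ne'
  have hK' : (K : ℝ) ≠ 0 := by positivity
  rw [exp3Rate]
  field_simp

lemma exp3Update_apply (γ : ℝ) (K : ℕ) (w : ℕ → ℝ) (n : ℕ) (r : ℝ) (i : ℕ) :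
    exp3Update γ K w n r i =
      w i * Real.exp (if n = i then exp3Rate γ K w n * r else 0) := by
  unfold exp3Update exp3Rate
  by_cases h : n = i
  · subst h
    simp only [Function.update_self, if_true]
    congr 2
    ring
  · rw [Function.update_of_ne (Ne.symm h)]
    simp [h]

lemma exp3Update_pos {γ : ℝ} {K : ℕ} {w : ℕ → ℝ} (hw : ∀ i, 0 < w i) (n : ℕ) (r : ℝ) (i : ℕ) :
    0 < exp3Update γ K w n r i := by
  rw [exp3Update_apply]
  exact mul_pos (hw i) (Real.exp_pos _)

lemma abs_exponent_le {γ : ℝ} (hγ0 : 0 < γ) (hγ1 : γ ≤ 1) {K : ℕ} (hK : 1 ≤ K) {w : ℕ → ℝ}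
    (hw : ∀ i, 0 < w i) (n i : ℕ) (r : ℝ) :
    |if n = i then exp3Rate γ K w n * r else 0| ≤ |r| := by
  split_ifs
  · rw [abs_mul, abs_of_nonneg (exp3Rate_nonneg hγ0 hγ1 hK hw n)]
    exact mul_le_of_le_one_left (abs_nonneg r) (exp3Rate_le_one hγ0 hγ1 hK hw n)
  · simp

/-- The logarithm of the share of arm `j` in the total weight. -/
def logShare (K j : ℕ) (w : ℕ → ℝ) : ℝ := Real.log (w j) - Real.log (∑ i ∈ Finset.range K, w i)

lemma logShare_nonpos {K j : ℕ} (hj : j < K) {w : ℕ → ℝ} (hw : ∀ i, 0 < w i) :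
    logShare K j w ≤ 0 := by
  have h : w j ≤ ∑ i ∈ Finset.range K, w i :=
    Finset.single_le_sum (f := w) (fun i _ => (hw i).le) (Finset.mem_range.2 hj)
  exact sub_nonpos.2 (Real.log_le_log (hw j) h)

lemma log_exp3Update {γ : ℝ} {K : ℕ} {w : ℕ → ℝ} (hw : ∀ i, 0 < w i) (n : ℕ) (r : ℝ) (i : ℕ) :
    Real.log (exp3Update γ K w n r i) =
      Real.log (w i) + if n = i then exp3Rate γ K w n * r else 0 := by
  rw [exp3Update_apply, Real.log_mul (hw i).ne' (Real.exp_pos _).ne', Real.log_exp]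

lemma sum_exp3Update {γ : ℝ} {K : ℕ} (w : ℕ → ℝ) {n : ℕ} (hn : n < K) (r : ℝ) :
    ∑ i ∈ Finset.range K, exp3Update γ K w n r i =
      ∑ i ∈ Finset.range K, w i + w n * (Real.exp (exp3Rate γ K w n * r) - 1) := by
  have h : ∀ i ∈ Finset.range K, exp3Update γ K w n r i =
      w i + if n = i then w n * (Real.exp (exp3Rate γ K w n * r) - 1) else 0 := by
    intro i _
    rw [exp3Update_apply]
    split_ifs with h
    · subst h; ring
    · simp
  rw [Finset.sum_congr rfl h, Finset.sum_add_distrib, Finset.sum_ite_eq,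
    if_pos (Finset.mem_range.2 hn)]

/-- Only one weight changes, so the total weight is multiplied by `1 + z` with `z` explicit; then
`log (1 + z) ≤ z`. -/
lemma logShare_exp3Update_ge {γ : ℝ} {K j : ℕ} (hK : 1 ≤ K) {w : ℕ → ℝ} (hw : ∀ i, 0 < w i)
    {n : ℕ} (hn : n < K) (r : ℝ) :
    (if n = j then exp3Rate γ K w n * r else 0) -
        w n / (∑ i ∈ Finset.range K, w i) * (Real.exp (exp3Rate γ K w n * r) - 1) ≤
      logShare K j (exp3Update γ K w n r) - logShare K j w := by
  have hW := sum_range_pos hK hw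
  have hW' := sum_range_pos hK (exp3Update_pos (γ := γ) (K := K) hw n r)
  have h1 : Real.log (∑ i ∈ Finset.range K, exp3Update γ K w n r i) -
      Real.log (∑ i ∈ Finset.range K, w i) ≤
      w n / (∑ i ∈ Finset.range K, w i) * (Real.exp (exp3Rate γ K w n * r) - 1) := by
    rw [← Real.log_div hW'.ne' hW.ne']
    refine (Real.log_le_sub_one_of_pos (div_pos hW' hW)).trans (le_of_eq ?_)
    rw [sum_exp3Update w hn r]
    field_simp
    ring
  rw [logShare, logShare, log_exp3Update hw]
  linarith

/-- Each log-weight, and hence the log of the total, moves by at most `|r|`. This crude bound serves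
only for integrability. -/
lemma abs_logShare_exp3Update_sub_le {γ : ℝ} (hγ0 : 0 < γ) (hγ1 : γ ≤ 1) {K j : ℕ} (hK : 1 ≤ K)
    {w : ℕ → ℝ} (hw : ∀ i, 0 < w i) (n : ℕ) (r : ℝ) :
    |logShare K j (exp3Update γ K w n r) - logShare K j w| ≤ 2 * |r| := by
  have hW := sum_range_pos hK hw
  have hW' := sum_range_pos hK (exp3Update_pos (γ := γ) (K := K) hw n r)
  have he := fun i => abs_le.1 (abs_exponent_le hγ0 hγ1 hK hw n i r)
  have hup : Real.log (∑ i ∈ Finset.range K, exp3Update γ K w n r i) ≤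
      Real.log (∑ i ∈ Finset.range K, w i) + |r| := by
    rw [← Real.log_exp |r|, ← Real.log_mul hW.ne' (Real.exp_pos _).ne']
    refine Real.log_le_log hW' ?_
    rw [Finset.sum_mul]
    refine Finset.sum_le_sum fun i _ => ?_
    rw [exp3Update_apply]
    exact mul_le_mul_of_nonneg_left (Real.exp_le_exp.2 (he i).2) (hw i).le
  have hlo : Real.log (∑ i ∈ Finset.range K, w i) + -|r| ≤
      Real.log (∑ i ∈ Finset.range K, exp3Update γ K w n r i) := by
    rw [← Real.log_exp (-|r|), ← Real.log_mul hW.ne' (Real.exp_pos _).ne']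
    refine Real.log_le_log (mul_pos hW (Real.exp_pos _)) ?_
    rw [Finset.sum_mul]
    refine Finset.sum_le_sum fun i _ => ?_
    rw [exp3Update_apply]
    exact mul_le_mul_of_nonneg_left (Real.exp_le_exp.2 (he i).1) (hw i).le
  have h3 := he j
  rw [logShare, logShare, log_exp3Update hw, abs_le]
  constructor <;> linarith [h3.1, h3.2]

/-! ### Exponential moments of noisy rewards -/

/-- For `|x| ≤ 1` this is the Taylor estimate. For `x ≤ -1` the left side is at most `1` and `x + x
^ 2 ≥ 0`; for `x ≥ 1` the last term alone dominates. -/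
lemma exp_le_one_add_add_sq {x c : ℝ} (hx : |x| ≤ c) :
    Real.exp x ≤ 1 + x + x ^ 2 * Real.exp c := by
  have hc : 1 ≤ Real.exp c := Real.one_le_exp ((abs_nonneg x).trans hx)
  have hxc : Real.exp x ≤ Real.exp c := Real.exp_le_exp.2 ((le_abs_self x).trans hx)
  have hsq : x ^ 2 ≤ x ^ 2 * Real.exp c := le_mul_of_one_le_right (sq_nonneg x) hc
  rcases le_total |x| 1 with h | h
  · have := (abs_le.1 (Real.abs_exp_sub_one_sub_id_le h)).2
    linarith
  · rcases le_abs'.1 h with h | h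
    · have : Real.exp x ≤ 1 := Real.exp_le_one_iff.2 (by linarith)
      nlinarith
    · have : Real.exp c ≤ x ^ 2 * Real.exp c :=
        le_mul_of_one_le_left (Real.exp_pos c).le (by nlinarith)
      linarith

/-- The law of the position within the interval and of the noise of one round. -/
abbrev rewardLaw (s : ℝ≥0) : Measure (unitInterval × ℝ) :=
  (volume : Measure unitInterval).prod (gaussianReal 0 s)

/-- The constant of the second order term of the exponential moment of a noisy reward. -/
def rewardConst (U : ℝ) (s : ℝ≥0) : ℝ := s / 2 + (U + s / 2) ^ 2 * Real.exp (U + s / 2)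

lemma rewardConst_nonneg (U : ℝ) (s : ℝ≥0) : 0 ≤ rewardConst U s := by
  unfold rewardConst
  positivity

lemma integrable_of_abs_le {U : ℝ} {f : unitInterval → ℝ} (hf : Measurable f)
    (hfU : ∀ y, |f y| ≤ U) :
    Integrable f (volume : Measure unitInterval) :=
  Integrable.of_bound hf.aestronglyMeasurable U (Filter.Eventually.of_forall hfU)

lemma abs_integral_le_of_abs_le {U : ℝ} {f : unitInterval → ℝ}
    (hfU : ∀ y, |f y| ≤ U) : |∫ y, f y| ≤ U := by
  have := norm_integral_le_of_norm_le_const (μ := (volume : Measure unitInterval)) (f := f)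
    (C := U) (Filter.Eventually.of_forall hfU)
  simpa using this

lemma integrable_reward {U : ℝ} {f : unitInterval → ℝ} (hf : Measurable f)
    (hfU : ∀ y, |f y| ≤ U) (s : ℝ≥0) :
    Integrable (fun z : unitInterval × ℝ => f z.1 + z.2) (rewardLaw s) := by
  have hg : Integrable (fun x : ℝ => x) (gaussianReal 0 s) :=
    (memLp_id_gaussianReal (μ := 0) (v := s) 1).integrable (by norm_num)
  exact ((integrable_of_abs_le hf hfU).comp_fst _).add (hg.comp_snd _)

lemma integral_reward {U : ℝ} {f : unitInterval → ℝ} (hf : Measurable f)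
    (hfU : ∀ y, |f y| ≤ U) (s : ℝ≥0) :
    ∫ z : unitInterval × ℝ, (f z.1 + z.2) ∂(rewardLaw s) = ∫ y, f y := by
  have hg : Integrable (fun x : ℝ => x) (gaussianReal 0 s) :=
    (memLp_id_gaussianReal (μ := 0) (v := s) 1).integrable (by norm_num)
  rw [integral_add ((integrable_of_abs_le hf hfU).comp_fst _) (hg.comp_snd _),
    integral_fun_fst, integral_fun_snd (fun x : ℝ => x)]
  simp

lemma integrable_exp_reward {U : ℝ} {f : unitInterval → ℝ} (hf : Measurable f)
    (hfU : ∀ y, |f y| ≤ U) (s : ℝ≥0) (a : ℝ) :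
    Integrable (fun z : unitInterval × ℝ => Real.exp (a * (f z.1 + z.2))) (rewardLaw s) := by
  have h1 : Integrable (fun y => Real.exp (a * f y)) (volume : Measure unitInterval) := by
    refine Integrable.of_bound (by fun_prop) (Real.exp (|a| * U))
      (Filter.Eventually.of_forall fun y => ?_)
    rw [Real.norm_eq_abs, abs_of_pos (Real.exp_pos _)]
    refine Real.exp_le_exp.2 ((le_abs_self _).trans ?_)
    rw [abs_mul]
    exact mul_le_mul_of_nonneg_left (hfU y) (abs_nonneg a)
  have h := h1.mul_prod (integrable_exp_mul_gaussianReal (μ := 0) (v := s) a)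
  refine h.congr (Filter.Eventually.of_forall fun z => ?_)
  simp only []
  rw [← Real.exp_add]
  ring_nf

/-- The Gaussian factor integrates to `exp (s * a ^ 2 / 2)` exactly, leaving the exponent `a * f y +
s * a ^ 2 / 2`, which is at most `a * (U + s / 2)` in absolute value because `a ^ 2 ≤ a`. Its linear
part contributes the `s / 2` in `rewardConst`, its square the rest. -/
lemma integral_exp_reward_le {U : ℝ} {f : unitInterval → ℝ} (hf : Measurable f)
    (hfU : ∀ y, |f y| ≤ U) (s : ℝ≥0) {a : ℝ} (ha0 : 0 ≤ a) (ha1 : a ≤ 1) :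
    ∫ z : unitInterval × ℝ, Real.exp (a * (f z.1 + z.2)) ∂(rewardLaw s) ≤
      1 + a * (∫ y, f y) + rewardConst U s * a ^ 2 := by
  have hInt := integrable_of_abs_le hf hfU
  have h1 : ∫ z : unitInterval × ℝ, Real.exp (a * (f z.1 + z.2)) ∂(rewardLaw s) =
      (∫ y, Real.exp (a * f y)) * Real.exp (s * a ^ 2 / 2) := by
    have hmgf : ∫ x, Real.exp (a * x) ∂(gaussianReal 0 s) = Real.exp (s * a ^ 2 / 2) := by
      have := congrFun (mgf_id_gaussianReal (μ := 0) (v := s)) a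
      simpa [mgf] using this
    rw [← hmgf, ← integral_prod_mul]
    refine integral_congr_ae (Filter.Eventually.of_forall fun z => ?_)
    simp only []
    rw [← Real.exp_add]
    ring_nf
  have h2 : ∀ y, Real.exp (a * f y) * Real.exp (s * a ^ 2 / 2) ≤
      1 + a * f y + rewardConst U s * a ^ 2 := by
    intro y
    have hs : (0 : ℝ) ≤ s := s.2
    have hU : 0 ≤ U := (abs_nonneg _).trans (hfU y)
    have hsq : a ^ 2 ≤ a := by nlinarith
    have hx : |a * f y + s * a ^ 2 / 2| ≤ a * (U + s / 2) := by
      refine (abs_add_le _ _).trans ?_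
      rw [abs_mul, abs_of_nonneg ha0, abs_of_nonneg (by positivity : 0 ≤ (s : ℝ) * a ^ 2 / 2)]
      nlinarith [mul_le_mul_of_nonneg_left (hfU y) ha0, mul_le_mul_of_nonneg_left hsq hs]
    have hx' : |a * f y + s * a ^ 2 / 2| ≤ U + s / 2 :=
      hx.trans (mul_le_of_le_one_left (by positivity) ha1)
    have hx2 : (a * f y + s * a ^ 2 / 2) ^ 2 ≤ (a * (U + s / 2)) ^ 2 :=
      sq_le_sq' (abs_le.1 hx).1 (abs_le.1 hx).2
    rw [← Real.exp_add]
    refine (exp_le_one_add_add_sq hx').trans ?_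
    have := mul_le_mul_of_nonneg_right hx2 (Real.exp_pos (U + s / 2)).le
    unfold rewardConst
    nlinarith
  rw [h1, ← integral_mul_const]
  calc ∫ y, Real.exp (a * f y) * Real.exp (s * a ^ 2 / 2)
      ≤ ∫ y, (1 + a * f y + rewardConst U s * a ^ 2) := by
        refine integral_mono_of_nonneg (Filter.Eventually.of_forall fun y => by positivity) ?_
          (Filter.Eventually.of_forall h2)
        exact ((integrable_const _).add (hInt.const_mul a)).add (integrable_const _)
    _ = 1 + a * (∫ y, f y) + rewardConst U s * a ^ 2 := by
        rw [integral_add (f := fun y => 1 + a * f y)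
            ((integrable_const _).add (hInt.const_mul a)) (integrable_const _),
          integral_add (integrable_const _) (hInt.const_mul a), integral_const_mul]
        simp

/-! ### EXP3 with noisy rewards -/

/-- The law of the randomness of one round of EXP3. -/
abbrev roundLaw (s : ℝ≥0) : Measure (unitInterval × unitInterval × ℝ) :=
  (volume : Measure unitInterval).prod (rewardLaw s)

/-- One round of EXP3, where `f n y` is the expected reward of arm `n` at position `y`. -/
def exp3Step (γ : ℝ) (K : ℕ) (f : ℕ → unitInterval → ℝ) (w : ℕ → ℝ)
    (z : unitInterval × unitInterval × ℝ) : ℕ → ℝ :=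
  exp3Update γ K w (sampleArm K (exp3Prob γ K w) z.1)
    (f (sampleArm K (exp3Prob γ K w) z.1) z.2.1 + z.2.2)

/-- The weights of EXP3, where `f t n y` is the expected reward in round `t`. -/
def exp3Run (γ : ℝ) (K : ℕ) (f : ℕ → ℕ → unitInterval → ℝ) (w₀ : ℕ → ℝ) (η : ExploitSample) :
    ℕ → ℕ → ℝ
  | 0 => w₀
  | t + 1 => exp3Step γ K (f t) (exp3Run γ K f w₀ η t) (η t)

lemma measurable_exp3Prob (γ : ℝ) (K n : ℕ) : Measurable fun w : ℕ → ℝ => exp3Prob γ K w n := by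
  unfold exp3Prob
  fun_prop

lemma measurable_exp3Update (γ : ℝ) (K n : ℕ) :
    Measurable fun q : (ℕ → ℝ) × ℝ => exp3Update γ K q.1 n q.2 := by
  refine measurable_pi_lambda _ fun i => ?_
  have hp : Measurable fun q : (ℕ → ℝ) × ℝ => exp3Prob γ K q.1 n :=
    (measurable_exp3Prob γ K n).comp measurable_fst
  simp only [exp3Update_apply, exp3Rate]
  split_ifs <;> fun_prop

lemma measurable_logShare (K j : ℕ) : Measurable (logShare K j) := by
  unfold logShare
  fun_prop

lemma measurable_exp3Arm (γ : ℝ) (K : ℕ) :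
    Measurable fun q : (ℕ → ℝ) × unitInterval => sampleArm K (exp3Prob γ K q.1) q.2 := by
  have h : Measurable fun q : (ℕ → ℝ) × unitInterval => (exp3Prob γ K q.1, q.2) :=
    (measurable_pi_lambda _ fun n => (measurable_exp3Prob γ K n).comp measurable_fst).prodMk
      measurable_snd
  have h2 := Measurable.comp (measurable_sampleArm K) h
  simpa only [Function.comp_def] using h2

/-- Measurability of a function of the weights and of the randomness of a round can be checked for
each value of the arm separately. -/
lemma measurable_of_arm {β : Type*} [MeasurableSpace β] (γ : ℝ) (K : ℕ)
    {G : ℕ → (ℕ → ℝ) × unitInterval × unitInterval × ℝ → β} (hG : ∀ n, Measurable (G n)) :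
    Measurable fun q : (ℕ → ℝ) × unitInterval × unitInterval × ℝ =>
      G (sampleArm K (exp3Prob γ K q.1) q.2.1) q := by
  have h1 : Measurable fun x : ℕ × ((ℕ → ℝ) × unitInterval × unitInterval × ℝ) => G x.1 x.2 :=
    measurable_from_prod_countable_right hG
  have h2 : Measurable fun q : (ℕ → ℝ) × unitInterval × unitInterval × ℝ =>
      sampleArm K (exp3Prob γ K q.1) q.2.1 := by
    have h3 : Measurable fun q : (ℕ → ℝ) × unitInterval × unitInterval × ℝ => (q.1, q.2.1) := by
      fun_prop
    have h4 := Measurable.comp (measurable_exp3Arm γ K) h3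
    simpa only [Function.comp_def] using h4
  have h5 := Measurable.comp h1 (h2.prodMk measurable_id)
  simpa only [Function.comp_def, id] using h5

lemma measurable_exp3Step (γ : ℝ) (K : ℕ) {f : ℕ → unitInterval → ℝ} (hf : ∀ n, Measurable (f n)) :
    Measurable fun q : (ℕ → ℝ) × unitInterval × unitInterval × ℝ => exp3Step γ K f q.1 q.2 := by
  refine measurable_of_arm γ K (G := fun n q => exp3Update γ K q.1 n (f n q.2.2.1 + q.2.2.2))
    fun n => ?_
  have h : Measurable fun q : (ℕ → ℝ) × unitInterval × unitInterval × ℝ =>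
      (q.1, f n q.2.2.1 + q.2.2.2) := by
    have := hf n
    fun_prop
  exact (measurable_exp3Update γ K n).comp h

lemma measurable_exp3Run (γ : ℝ) (K : ℕ) {f : ℕ → ℕ → unitInterval → ℝ}
    (hf : ∀ t n, Measurable (f t n)) (w₀ : ℕ → ℝ) (t : ℕ) :
    Measurable fun η => exp3Run γ K f w₀ η t := by
  induction t with
  | zero => exact measurable_const
  | succ t ih =>
    have h : Measurable fun η : ExploitSample => (exp3Run γ K f w₀ η t, η t) :=
      ih.prodMk (measurable_pi_apply t)
    have h2 := Measurable.comp (measurable_exp3Step γ K (hf t)) h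
    simpa only [Function.comp_def, exp3Run] using h2

lemma exp3Run_congr (γ : ℝ) (K : ℕ) (f : ℕ → ℕ → unitInterval → ℝ) (w₀ : ℕ → ℝ) (t : ℕ)
    (η η' : ExploitSample) (h : ∀ i < t, η i = η' i) :
    exp3Run γ K f w₀ η t = exp3Run γ K f w₀ η' t := by
  induction t with
  | zero => rfl
  | succ t ih =>
    simp only [exp3Run]
    rw [ih fun i hi => h i (hi.trans (Nat.lt_succ_self t)), h t (Nat.lt_succ_self t)]

lemma exp3Run_pos (γ : ℝ) (K : ℕ) (f : ℕ → ℕ → unitInterval → ℝ) {w₀ : ℕ → ℝ}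
    (hw : ∀ i, 0 < w₀ i) (η : ExploitSample) (t i : ℕ) : 0 < exp3Run γ K f w₀ η t i := by
  induction t generalizing i with
  | zero => exact hw i
  | succ t ih => exact exp3Update_pos ih _ _ i

/-- This is the drift conditional on the played arm `i`. The added `γ / K * f` is the played reward,
so that averaging over `i` compares arm `j` with the policy. -/
lemma integral_logShare_exp3Update_ge {γ : ℝ} (hγ0 : 0 < γ) (hγ1 : γ ≤ 1) {K j : ℕ} (hK : 1 ≤ K)
    {U : ℝ} {f : unitInterval → ℝ} (hf : Measurable f) (hfU : ∀ y, |f y| ≤ U) (s : ℝ≥0)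
    {w : ℕ → ℝ} (hw : ∀ i, 0 < w i) {i : ℕ} (hi : i < K) :
    Integrable (fun z : unitInterval × ℝ => logShare K j (exp3Update γ K w i (f z.1 + z.2)) -
        logShare K j w + γ / K * f z.1) (rewardLaw s) ∧
    (if i = j then exp3Rate γ K w i * (∫ y, f y) else 0) -
        w i / (∑ i ∈ Finset.range K, w i) * (exp3Rate γ K w i * (∫ y, f y) +
          rewardConst U s * exp3Rate γ K w i ^ 2) + γ / K * (∫ y, f y) ≤
      ∫ z : unitInterval × ℝ, (logShare K j (exp3Update γ K w i (f z.1 + z.2)) -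
        logShare K j w + γ / K * f z.1) ∂(rewardLaw s) := by
  set a := exp3Rate γ K w i with ha
  set q := w i / (∑ i ∈ Finset.range K, w i) with hq
  have hq0 : 0 ≤ q := div_nonneg (hw i).le (sum_range_pos hK hw).le
  have hr := integrable_reward hf hfU s
  have hfi : Integrable (fun z : unitInterval × ℝ => f z.1) (rewardLaw s) :=
    (integrable_of_abs_le hf hfU).comp_fst _
  have hexp := integrable_exp_reward hf hfU s a
  have hint1 : Integrable (fun z : unitInterval × ℝ =>
      logShare K j (exp3Update γ K w i (f z.1 + z.2)) - logShare K j w) (rewardLaw s) := by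
    refine Integrable.mono' (hr.abs.const_mul 2) ?_ (Filter.Eventually.of_forall fun z => ?_)
    · have h1 : Measurable fun z : unitInterval × ℝ => (w, f z.1 + z.2) := by fun_prop
      have h2 := (measurable_logShare K j).comp ((measurable_exp3Update γ K i).comp h1)
      exact (h2.sub measurable_const).aestronglyMeasurable
    · exact abs_logShare_exp3Update_sub_le hγ0 hγ1 hK hw i _
  have hint2 : Integrable (fun z : unitInterval × ℝ =>
      (if i = j then a * (f z.1 + z.2) else 0)) (rewardLaw s) := by
    split_ifs
    · exact hr.const_mul a
    · exact integrable_zero _ _ _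
  have hint3 : Integrable (fun z : unitInterval × ℝ =>
      q * (Real.exp (a * (f z.1 + z.2)) - 1)) (rewardLaw s) :=
    (hexp.sub (integrable_const 1)).const_mul q
  have hint4 := hint1.add (hfi.const_mul (γ / K))
  refine ⟨hint4, ?_⟩
  have hmono : ∫ z : unitInterval × ℝ, ((if i = j then a * (f z.1 + z.2) else 0) -
      q * (Real.exp (a * (f z.1 + z.2)) - 1) + γ / K * f z.1) ∂(rewardLaw s) ≤
      ∫ z : unitInterval × ℝ, (logShare K j (exp3Update γ K w i (f z.1 + z.2)) -
        logShare K j w + γ / K * f z.1) ∂(rewardLaw s) := by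
    refine integral_mono ((hint2.sub hint3).add (hfi.const_mul (γ / K))) hint4 fun z => ?_
    have := logShare_exp3Update_ge (γ := γ) (j := j) hK hw hi (f z.1 + z.2)
    simp only [ha, hq]
    linarith
  refine le_trans ?_ hmono
  rw [integral_add (f := fun z : unitInterval × ℝ => (if i = j then a * (f z.1 + z.2) else 0) -
      q * (Real.exp (a * (f z.1 + z.2)) - 1)) (hint2.sub hint3) (hfi.const_mul (γ / K)),
    integral_sub hint2 hint3, integral_const_mul, integral_const_mul,
    integral_sub hexp (integrable_const 1)]
  have e1 : ∫ z : unitInterval × ℝ, (if i = j then a * (f z.1 + z.2) else 0) ∂(rewardLaw s) =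
      if i = j then a * (∫ y, f y) else 0 := by
    split_ifs
    · rw [integral_const_mul, integral_reward hf hfU]
    · simp
  have e2 : ∫ z : unitInterval × ℝ, f z.1 ∂(rewardLaw s) = ∫ y, f y := by
    rw [integral_fun_fst]; simp
  have e3 := integral_exp_reward_le hf hfU s (exp3Rate_nonneg hγ0 hγ1 hK hw i)
    (exp3Rate_le_one hγ0 hγ1 hK hw i)
  have e4 : ∫ _ : unitInterval × ℝ, (1 : ℝ) ∂(rewardLaw s) = 1 := by simp
  rw [e1, e2, e4]
  have := mul_le_mul_of_nonneg_left e3 hq0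
  simp only [← ha] at this
  nlinarith

/-- The drift of the logarithmic share of an arm in one round of EXP3. -/
lemma exp3Step_drift {γ : ℝ} (hγ0 : 0 < γ) (hγ : γ ≤ 1 / 2) {K j : ℕ} (hj : j < K)
    {U : ℝ} {f : ℕ → unitInterval → ℝ} (hf : ∀ n, Measurable (f n)) (hfU : ∀ n y, |f n y| ≤ U)
    (s : ℝ≥0) {w : ℕ → ℝ} (hw : ∀ i, 0 < w i) :
    γ / K * ((∫ y, f j y) - 2 * γ * (U + rewardConst U s)) ≤
      ∫ z, (logShare K j (exp3Step γ K f w z) - logShare K j w +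
        γ / K * f (sampleArm K (exp3Prob γ K w) z.1) z.2.1) ∂(roundLaw s) := by
  have hK : 1 ≤ K := by omega
  have hγ1 : γ ≤ 1 := by linarith
  have hK' : (0 : ℝ) < K := by exact_mod_cast hK
  have hU : 0 ≤ U := (abs_nonneg _).trans (hfU 0 0)
  have hC := rewardConst_nonneg U s
  have hW := sum_range_pos hK hw
  have hstep := fun i (hi : i < K) =>
    integral_logShare_exp3Update_ge (j := j) hγ0 hγ1 hK (hf i) (hfU i) s hw hi
  have key := integral_sampleArm (rewardLaw s) hK
    (fun i => (exp3Prob_pos hγ0 hγ1 hK hw i).le) (sum_exp3Prob γ hK hw)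
    (h := fun i z => logShare K j (exp3Update γ K w i (f i z.1 + z.2)) -
        logShare K j w + γ / K * f i z.1) (fun i hi => (hstep i hi).1)
  simp only [exp3Step]
  rw [key]
  have hterm : ∀ i ∈ Finset.range K,
      γ / K * ((if i = j then ∫ y, f i y else 0) -
        γ * U * (1 / K + w i / (∑ i ∈ Finset.range K, w i)) - 2 * rewardConst U s * γ * (1 / K)) ≤
      exp3Prob γ K w i * ∫ z : unitInterval × ℝ, (logShare K j
        (exp3Update γ K w i (f i z.1 + z.2)) - logShare K j w + γ / K * f i z.1) ∂(rewardLaw s) := by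
    intro i hi
    have hp := exp3Prob_pos hγ0 hγ1 hK hw i
    have hpa := exp3Prob_mul_exp3Rate hγ0 hγ1 hK hw i
    refine le_trans ?_ (mul_le_mul_of_nonneg_left (hstep i (Finset.mem_range.1 hi)).2 hp.le)
    have hm := abs_le.1 (abs_integral_le_of_abs_le (hfU i))
    have hpdef : exp3Prob γ K w i =
        (1 - γ) * (w i / ∑ i ∈ Finset.range K, w i) + γ * (1 / K) := by
      rw [exp3Prob]; ring
    have hq0 : 0 ≤ w i / ∑ i ∈ Finset.range K, w i := div_nonneg (hw i).le hW.le
    have hqa : w i / (∑ i ∈ Finset.range K, w i) * exp3Rate γ K w i ≤ 2 * γ * (1 / K) := by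
      have ha := exp3Rate_nonneg hγ0 hγ1 hK hw i
      -- Here `γ ≤ 1/2` enters: the probability is at least `(1 - γ)` times the share. This makes
      -- the second-order term `q * a ^ 2`, weighted by `p`, of order `(γ / K) ^ 2`.
      have h1 : w i / (∑ i ∈ Finset.range K, w i) ≤ 2 * exp3Prob γ K w i := by
        have : 0 ≤ γ * (1 / (K : ℝ)) := by positivity
        rw [hpdef]
        nlinarith
      calc _ ≤ 2 * exp3Prob γ K w i * exp3Rate γ K w i := mul_le_mul_of_nonneg_right h1 ha
        _ = 2 * γ * (1 / K) := by rw [mul_assoc, hpa]; ring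
    generalize w i / (∑ i ∈ Finset.range K, w i) = q at *
    generalize exp3Rate γ K w i = a at *
    generalize (∫ y, f i y) = m at *
    generalize exp3Prob γ K w i = p at *
    have hrhs : p * ((if i = j then a * m else 0) - q * (a * m + rewardConst U s * a ^ 2) +
        γ / K * m) = γ / K * ((if i = j then m else 0) + (p - q) * m -
          rewardConst U s * (q * a)) := by
      rw [← hpa]
      split_ifs <;> ring
    rw [hrhs]
    refine mul_le_mul_of_nonneg_left ?_ (by positivity)
    -- The probability differs from the share by `γ * (1 / K - q)`. Summed over arms, `1 / K + q`
    -- gives `2`, whence the `2 * γ * U` in the drift.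
    have h1 : -(γ * U * (1 / K + q)) ≤ (p - q) * m := by
      have : (p - q) * m = γ * (1 / K) * m - γ * q * m := by rw [hpdef]; ring
      have h2 : 0 ≤ γ * (1 / (K : ℝ)) := by positivity
      have h3 : 0 ≤ γ * q := by positivity
      nlinarith [mul_le_mul_of_nonneg_left hm.1 h2, mul_le_mul_of_nonneg_left hm.2 h3]
    have h4 := mul_le_mul_of_nonneg_left hqa hC
    linarith
  refine le_trans (le_of_eq ?_) (Finset.sum_le_sum hterm)
  have hqsum : ∑ i ∈ Finset.range K, w i / (∑ i ∈ Finset.range K, w i) = 1 := by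
    rw [← Finset.sum_div, div_self hW.ne']
  rw [← Finset.mul_sum, Finset.sum_sub_distrib, Finset.sum_sub_distrib, Finset.sum_ite_eq',
    if_pos (Finset.mem_range.2 hj), ← Finset.mul_sum, Finset.sum_add_distrib, hqsum]
  simp only [Finset.sum_const, Finset.card_range, nsmul_eq_mul]
  field_simp
  ring

instance isProbabilityMeasure_exploitLaw (s : ℝ≥0) : IsProbabilityMeasure (exploitLaw s) := by
  unfold exploitLaw
  infer_instance

lemma integrable_abs_noise (s : ℝ≥0) (t : ℕ) :
    Integrable (fun η : ExploitSample => |(η t).2.2|) (exploitLaw s) := by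
  have hg : Integrable (fun x : ℝ => |x|) (gaussianReal 0 s) :=
    ((memLp_id_gaussianReal (μ := 0) (v := s) 1).integrable (by norm_num)).abs
  have h1 : Integrable (fun z : unitInterval × unitInterval × ℝ => |z.2.2|) (roundLaw s) :=
    (hg.comp_snd (volume : Measure unitInterval)).comp_snd (volume : Measure unitInterval)
  exact (measurePreserving_eval_infinitePi (fun _ : ℕ => roundLaw s) t).integrable_comp_of_integrable
    h1

/-- The arm played by EXP3 in round `t`. -/
def exp3RunArm (γ : ℝ) (K : ℕ) (f : ℕ → ℕ → unitInterval → ℝ) (w₀ : ℕ → ℝ) (η : ExploitSample)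
    (t : ℕ) : ℕ :=
  sampleArm K (exp3Prob γ K (exp3Run γ K f w₀ η t)) (η t).1

lemma measurable_exp3Run_reward (γ : ℝ) (K : ℕ) {f : ℕ → ℕ → unitInterval → ℝ}
    (hf : ∀ t n, Measurable (f t n)) (w₀ : ℕ → ℝ) (t : ℕ) :
    Measurable fun η : ExploitSample => f t (exp3RunArm γ K f w₀ η t) (η t).2.1 := by
  have h1 := measurable_of_arm γ K (G := fun n q => f t n q.2.2.1)
    fun n => (hf t n).comp (by fun_prop)
  have h2 : Measurable fun η : ExploitSample => (exp3Run γ K f w₀ η t, η t) :=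
    (measurable_exp3Run γ K hf w₀ t).prodMk (measurable_pi_apply t)
  have h3 := Measurable.comp h1 h2
  simpa only [Function.comp_def, exp3RunArm] using h3

lemma integrable_exp3Run_reward (γ : ℝ) (K : ℕ) {U : ℝ} {f : ℕ → ℕ → unitInterval → ℝ}
    (hf : ∀ t n, Measurable (f t n)) (hfU : ∀ t n y, |f t n y| ≤ U) (s : ℝ≥0) (w₀ : ℕ → ℝ) (t : ℕ) :
    Integrable (fun η : ExploitSample => f t (exp3RunArm γ K f w₀ η t) (η t).2.1)
      (exploitLaw s) :=
  Integrable.of_bound (measurable_exp3Run_reward γ K hf w₀ t).aestronglyMeasurable U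
    (Filter.Eventually.of_forall fun _ => hfU _ _ _)

/-- The expected regret of EXP3 with noisy rewards and arbitrary initial weights with respect to a
fixed arm. -/
theorem exp3_regret {γ : ℝ} (hγ0 : 0 < γ) (hγ : γ ≤ 1 / 2) {K j : ℕ} (hj : j < K)
    {U : ℝ} {f : ℕ → ℕ → unitInterval → ℝ} (hf : ∀ t n, Measurable (f t n))
    (hfU : ∀ t n y, |f t n y| ≤ U) (s : ℝ≥0) {w₀ : ℕ → ℝ} (hw : ∀ i, 0 < w₀ i) (n : ℕ) :
    ∑ t ∈ Finset.range n, (∫ y, f t j y) -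
        ∑ t ∈ Finset.range n, ∫ η, f t (exp3RunArm γ K f w₀ η t) (η t).2.1 ∂(exploitLaw s) ≤
      K / γ * (-logShare K j w₀) + 2 * γ * n * (U + rewardConst U s) := by
  have hγ1 : γ ≤ 1 := by linarith
  have hK : 1 ≤ K := by omega
  have hK' : (0 : ℝ) < K := by exact_mod_cast hK
  have hpos := fun η t => exp3Run_pos γ K f hw η t
  have hVm : ∀ t, Measurable fun η => logShare K j (exp3Run γ K f w₀ η t) := fun t =>
    (measurable_logShare K j).comp (measurable_exp3Run γ K hf w₀ t)
  have hdiff : ∀ t, Integrable (fun η => logShare K j (exp3Run γ K f w₀ η (t + 1)) -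
      logShare K j (exp3Run γ K f w₀ η t)) (exploitLaw s) := by
    intro t
    refine Integrable.mono' (((integrable_const U).add (integrable_abs_noise s t)).const_mul 2)
      ((hVm (t + 1)).sub (hVm t)).aestronglyMeasurable (Filter.Eventually.of_forall fun η => ?_)
    refine (abs_logShare_exp3Update_sub_le hγ0 hγ1 hK (hpos η t) _ _).trans ?_
    refine mul_le_mul_of_nonneg_left ?_ zero_le_two
    exact (abs_add_le _ _).trans (add_le_add_left (hfU _ _ _) _)
  have hVint : ∀ t, Integrable (fun η => logShare K j (exp3Run γ K f w₀ η t)) (exploitLaw s) := by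
    intro t
    induction t with
    | zero => simpa only [exp3Run] using integrable_const (logShare K j w₀)
    | succ t ih =>
      refine ((hdiff t).add ih).congr (Filter.Eventually.of_forall fun η => ?_)
      simp
  have hround : ∀ t, γ / K * ((∫ y, f t j y) - 2 * γ * (U + rewardConst U s)) ≤
      ∫ η, logShare K j (exp3Run γ K f w₀ η (t + 1)) ∂(exploitLaw s) -
        ∫ η, logShare K j (exp3Run γ K f w₀ η t) ∂(exploitLaw s) +
        γ / K * ∫ η, f t (exp3RunArm γ K f w₀ η t) (η t).2.1 ∂(exploitLaw s) := by
    intro t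
    have hri := integrable_exp3Run_reward γ K hf hfU s w₀ t
    rw [← integral_sub (hVint (t + 1)) (hVint t), ← integral_const_mul,
      ← integral_add (hdiff t) (hri.const_mul _)]
    refine le_integral_eval_infinitePi (roundLaw s) (measurable_exp3Run γ K hf w₀ t) t
      (exp3Run_congr γ K f w₀ t)
      (G := fun q => logShare K j (exp3Step γ K (f t) q.1 q.2) - logShare K j q.1 +
        γ / K * f t (sampleArm K (exp3Prob γ K q.1) q.2.1) q.2.2.1) ?_
      ((hdiff t).add (hri.const_mul _))
      fun η => exp3Step_drift hγ0 hγ hj (hf t) (hfU t) s (hpos η t)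
    have h1 := measurable_of_arm γ K (G := fun n q => f t n q.2.2.1)
      fun n => (hf t n).comp (by fun_prop)
    exact (((measurable_logShare K j).comp (measurable_exp3Step γ K (hf t))).sub
      ((measurable_logShare K j).comp measurable_fst)).add (h1.const_mul _)
  have hsum := Finset.sum_le_sum fun t (_ : t ∈ Finset.range n) => hround t
  rw [Finset.sum_add_distrib,
    Finset.sum_range_sub (fun t => ∫ η, logShare K j (exp3Run γ K f w₀ η t) ∂(exploitLaw s)),
    ← Finset.mul_sum, ← Finset.mul_sum, Finset.sum_sub_distrib] at hsum
  have hV0 : ∫ η, logShare K j (exp3Run γ K f w₀ η 0) ∂(exploitLaw s) = logShare K j w₀ := by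
    simp [exp3Run]
  -- After telescoping, the final potential is discarded by its sign and only the initial share of
  -- arm `j` remains.
  have hVn : ∫ η, logShare K j (exp3Run γ K f w₀ η n) ∂(exploitLaw s) ≤ 0 :=
    integral_nonpos fun η => logShare_nonpos hj (hpos η n)
  rw [hV0] at hsum
  simp only [Finset.sum_const, Finset.card_range, nsmul_eq_mul] at hsum
  have h1 : γ / K * (∑ t ∈ Finset.range n, (∫ y, f t j y) -
      ∑ t ∈ Finset.range n, ∫ η, f t (exp3RunArm γ K f w₀ η t) (η t).2.1 ∂(exploitLaw s) -
      2 * γ * n * (U + rewardConst U s)) ≤ -logShare K j w₀ := by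
    linarith
  have h2 := mul_le_mul_of_nonneg_left h1 (by positivity : 0 ≤ K / γ)
  have h3 : K / γ * (γ / K) = 1 := by field_simp
  rw [← mul_assoc, h3, one_mul] at h2
  linarith

/-! ### Exploration -/

lemma samplePoint_mem {K n : ℕ} (hn : n < K) (y : unitInterval) :
    samplePoint K n y ∈ Icc (0 : ℝ) 1 := by
  have hK : (0 : ℝ) < K := by exact_mod_cast Nat.zero_lt_of_lt hn
  have h1 : (n : ℝ) + 1 ≤ K := by exact_mod_cast hn
  have hy := y.2
  refine ⟨div_nonneg (add_nonneg (Nat.cast_nonneg n) hy.1) hK.le, ?_⟩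
  rw [samplePoint, div_le_one hK]
  linarith [hy.2]

lemma exists_cell {K : ℕ} (hK : 1 ≤ K) {x : ℝ} (hx : x ∈ Icc (0 : ℝ) 1) :
    ∃ i < K, ∀ y, |x - samplePoint K i y| ≤ 1 / K := by
  have hK' : (0 : ℝ) < K := by exact_mod_cast hK
  have hcell : ∃ i < K, (i : ℝ) ≤ x * K ∧ x * K ≤ i + 1 := by
    rcases lt_or_ge ⌊x * K⌋₊ K with h | h
    · exact ⟨_, h, Nat.floor_le (mul_nonneg hx.1 hK'.le), (Nat.lt_floor_add_one _).le⟩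
    -- The floor reaches `K` only at `x = 1`, which belongs to the last cell.
    · have h1 : (K : ℝ) ≤ x * K := (Nat.le_floor_iff (mul_nonneg hx.1 hK'.le)).1 h
      have h2 : x * K ≤ K := mul_le_of_le_one_left hK'.le hx.2
      refine ⟨K - 1, by omega, ?_, ?_⟩ <;> push_cast [Nat.cast_sub hK] <;> linarith
  obtain ⟨i, hi, h1, h2⟩ := hcell
  refine ⟨i, hi, fun y => ?_⟩
  have hy := y.2
  have : x - samplePoint K i y = (x * K - (i + y)) / K := by
    rw [samplePoint]
    field_simp
  rw [this, abs_div, abs_of_pos hK']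
  refine div_le_div_of_nonneg_right ?_ hK'.le
  rw [abs_le]
  constructor <;> linarith [hy.1, hy.2]

namespace Params

/-- The outcome of Phase I is good up to `B` if each arm was pulled `A` times and no noise exceeds
`B` in absolute value. -/
def IsGood (P : Params) (B : ℝ) (ω : ExploreSample) : Prop :=
  (∀ n < P.N, ((Finset.range (P.A * P.N)).filter fun t => ω.1 t = n).card = P.A) ∧
    ∀ t < P.A * P.N, |(ω.2 t).2| ≤ B

/-- The `N` arms with `A` pulls each already fill all `A * N` rounds, which leaves no round for any
other index. -/
lemma IsGood.arm_lt {P : Params} {B : ℝ} {ω : ExploreSample} (h : P.IsGood B ω) {t : ℕ}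
    (ht : t < P.T₁) : ω.1 t < P.N := by
  have hcard : ((Finset.range P.T₁).filter fun t => ω.1 t < P.N).card =
      (Finset.range P.T₁).card := by
    rw [Finset.card_eq_sum_card_fiberwise (f := ω.1) (t := Finset.range P.N)
      (fun t ht => by simpa using (Finset.mem_filter.1 ht).2)]
    have : ∀ n ∈ Finset.range P.N, (((Finset.range P.T₁).filter fun t => ω.1 t < P.N).filter
        fun t => ω.1 t = n).card = P.A := by
      intro n hn
      rw [← h.1 n (Finset.mem_range.1 hn), Finset.filter_filter]
      congr 1
      refine Finset.filter_congr fun t _ => ⟨fun h => h.2, fun h => ⟨?_, h⟩⟩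
      rw [h]
      exact Finset.mem_range.1 hn
    rw [Finset.sum_congr rfl this]
    simp [T₁, mul_comm]
  have := Finset.filter_card_eq hcard t (Finset.mem_range.2 ht)
  exact this

variable {P : Params} {L H U B : ℝ} {u : ℕ → ℝ → ℝ} {ω : ExploreSample}

lemma abs_exploreReward_le (hT : P.T₁ ≤ P.T) (hu : ∀ t < P.T, IsUtility L H U (u t))
    (hω : P.IsGood B ω) {t : ℕ} (ht : t < P.T₁) : |P.exploreReward u ω t| ≤ U + B := by
  refine (abs_add_le _ _).trans (add_le_add ?_ (hω.2 t ht))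
  exact (hu t (ht.trans_le hT)).bounded _ (samplePoint_mem (hω.arm_lt ht) _)

lemma exploreWeight_pos (P : Params) (u : ℕ → ℝ → ℝ) (ω : ExploreSample) (t n : ℕ) :
    0 < P.exploreWeight u ω t n := by
  induction t generalizing n with
  | zero => exact one_pos
  | succ t ih => exact exp3Update_pos ih _ _ n

lemma abs_log_exploreWeight_le (hN : 1 ≤ P.N) (hγ0 : 0 < P.γ) (hγ1 : P.γ ≤ 1) (hT : P.T₁ ≤ P.T)
    (hu : ∀ t < P.T, IsUtility L H U (u t)) (hω : P.IsGood B ω) {t : ℕ} (ht : t ≤ P.T₁) (n : ℕ) :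
    |Real.log (P.exploreWeight u ω t n)| ≤ t * (U + B) := by
  induction t with
  | zero => simp [exploreWeight]
  | succ t ih =>
    have hw := P.exploreWeight_pos u ω t
    rw [exploreWeight, log_exp3Update hw]
    refine (abs_add_le _ _).trans ?_
    have h1 := ih (by omega)
    have h2 := (abs_exponent_le hγ0 hγ1 hN hw (ω.1 t) n (P.exploreReward u ω t)).trans
      (abs_exploreReward_le hT hu hω (by omega))
    push_cast
    linarith

lemma abs_exploreMean_le (hA : 1 ≤ P.A) (hT : P.T₁ ≤ P.T)
    (hu : ∀ t < P.T, IsUtility L H U (u t)) (hω : P.IsGood B ω) {n : ℕ} (hn : n < P.N) :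
    |P.exploreMean u ω n| ≤ U + B := by
  have hcard : ((Finset.range P.T₁).filter fun t => ω.1 t = n).card = P.A := hω.1 n hn
  have hA' : (0 : ℝ) < P.A := by exact_mod_cast hA
  rw [exploreMean, hcard, abs_div, abs_of_pos hA', div_le_iff₀ hA']
  refine (Finset.abs_sum_le_sum_abs _ _).trans ?_
  refine (Finset.sum_le_card_nsmul _ _ (U + B) fun t ht => ?_).trans (le_of_eq ?_)
  · exact abs_exploreReward_le hT hu hω (Finset.mem_range.1 (Finset.mem_filter.1 ht).1)
  · rw [hcard, nsmul_eq_mul, mul_comm]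

lemma lipHat_nonneg (P : Params) (u : ℕ → ℝ → ℝ) (ω : ExploreSample) : 0 ≤ P.lipHat u ω :=
  mul_nonneg (Nat.cast_nonneg _) (Real.iSup_nonneg fun _ => abs_nonneg _)

lemma lipHat_le (hA : 1 ≤ P.A) (hN : 1 ≤ P.N) (hT : P.T₁ ≤ P.T)
    (hu : ∀ t < P.T, IsUtility L H U (u t)) (hω : P.IsGood B ω) :
    P.lipHat u ω ≤ P.N * (2 * (U + B)) := by
  have h0 : 0 ≤ U + B := (abs_nonneg _).trans (abs_exploreMean_le hA hT hu hω hN)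
  refine mul_le_mul_of_nonneg_left (Real.iSup_le (fun n => ?_) (by linarith)) (Nat.cast_nonneg _)
  have hn := n.2
  have h1 := abs_exploreMean_le hA hT hu hω (n := n) (by omega)
  have h2 := abs_exploreMean_le hA hT hu hω (n := n + 1) (by omega)
  exact (abs_sub _ _).trans (by linarith)

/-! ### Exploitation as a run of EXP3 -/

lemma initWeight_pos (hN : 1 ≤ P.N) (hK : 1 ≤ P.numArms u ω) (n : ℕ) :
    0 < P.initWeight u ω n := by
  have h1 : (0 : ℝ) < P.N := by exact_mod_cast hN
  have h2 : (0 : ℝ) < P.numArms u ω := by exact_mod_cast hK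
  exact mul_pos (div_pos h1 h2) (P.exploreWeight_pos u ω _ _)

/-- The common factor `N / numArms` cancels in the share. The remaining factors lie between `exp
(-(T₁ * (U + B)))` and `exp (T₁ * (U + B))`. -/
lemma neg_logShare_initWeight_le (hN : 1 ≤ P.N) (hU : 0 ≤ U + B) (hγ0 : 0 < P.γ) (hγ1 : P.γ ≤ 1)
    (hT : P.T₁ ≤ P.T) (hu : ∀ t < P.T, IsUtility L H U (u t)) (hω : P.IsGood B ω)
    (hK : 1 ≤ P.numArms u ω) (j : ℕ) :
    -logShare (P.numArms u ω) j (P.initWeight u ω) ≤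
      2 * (P.T₁ * (U + B)) + Real.log (P.numArms u ω) := by
  have h1 : (0 : ℝ) < P.N := by exact_mod_cast hN
  have h2 : (0 : ℝ) < P.numArms u ω := by exact_mod_cast hK
  have hc : 0 < (P.N : ℝ) / P.numArms u ω := div_pos h1 h2
  have hlog : ∀ n, |Real.log (P.exploreWeight u ω (P.T₁ - 1) n)| ≤ P.T₁ * (U + B) := fun n =>
    (abs_log_exploreWeight_le hN hγ0 hγ1 hT hu hω (Nat.sub_le _ _) n).trans
      (mul_le_mul_of_nonneg_right (by exact_mod_cast Nat.sub_le _ _) hU)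
  have hj : Real.log ((P.N : ℝ) / P.numArms u ω) - P.T₁ * (U + B) ≤
      Real.log (P.initWeight u ω j) := by
    rw [initWeight, Real.log_mul hc.ne' (P.exploreWeight_pos u ω _ _).ne']
    linarith [(abs_le.1 (hlog (j * P.N / P.numArms u ω))).1]
  have hle : ∀ i, P.initWeight u ω i ≤
      (P.N : ℝ) / P.numArms u ω * Real.exp (P.T₁ * (U + B)) := fun i => by
    refine mul_le_mul_of_nonneg_left ?_ hc.le
    rw [← Real.log_le_iff_le_exp (P.exploreWeight_pos u ω _ _)]
    exact (abs_le.1 (hlog _)).2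
  have hsum : Real.log (∑ i ∈ Finset.range (P.numArms u ω), P.initWeight u ω i) ≤
      Real.log (P.numArms u ω) + (Real.log ((P.N : ℝ) / P.numArms u ω) + P.T₁ * (U + B)) := by
    have hexp : Real.log (P.numArms u ω) +
        (Real.log ((P.N : ℝ) / P.numArms u ω) + P.T₁ * (U + B)) = Real.log ((P.numArms u ω) *
          ((P.N : ℝ) / P.numArms u ω * Real.exp (P.T₁ * (U + B)))) := by
      rw [Real.log_mul h2.ne' (by positivity), Real.log_mul hc.ne' (Real.exp_pos _).ne',
        Real.log_exp]
    rw [hexp]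
    refine Real.log_le_log (sum_range_pos hK (initWeight_pos hN hK)) ?_
    refine (Finset.sum_le_card_nsmul _ _ _ fun i _ => hle i).trans (le_of_eq ?_)
    rw [Finset.card_range, nsmul_eq_mul]
  rw [logShare]
  linarith

/-- The expected reward of arm `n` at position `y` in round `j` of Phase II (set to `0` outside the
run). -/
def exploitReward (P : Params) (u : ℕ → ℝ → ℝ) (ω : ExploreSample) (j n : ℕ) (y : unitInterval) :
    ℝ :=
  if P.T₁ + j < P.T ∧ n < P.numArms u ω then u (P.T₁ + j) (samplePoint (P.numArms u ω) n y) else 0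

lemma measurable_exploitReward (hu : ∀ t < P.T, IsUtility L H U (u t)) (j n : ℕ) :
    Measurable (P.exploitReward u ω j n) := by
  unfold exploitReward
  by_cases h : P.T₁ + j < P.T ∧ n < P.numArms u ω
  · simp only [h, and_self, if_true]
    have hc : Continuous fun y => samplePoint (P.numArms u ω) n y := by
      unfold samplePoint
      fun_prop
    exact ((hu _ h.1).contDiffOn.continuousOn.comp_continuous hc
      fun y => samplePoint_mem h.2 y).measurable
  · simp only [h, if_false]
    exact measurable_const

lemma abs_exploitReward_le (hU : 0 ≤ U) (hu : ∀ t < P.T, IsUtility L H U (u t)) (j n : ℕ)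
    (y : unitInterval) : |P.exploitReward u ω j n y| ≤ U := by
  unfold exploitReward
  split_ifs with h
  · exact (hu _ h.1).bounded _ (samplePoint_mem h.2 y)
  · simpa using hU

/-- Sampled arms are always below `numArms`, so before the horizon the zero extension in
`exploitReward` is never used. -/
lemma exploitWeight_eq (hK : 1 ≤ P.numArms u ω) (η : ExploitSample) {j : ℕ}
    (hj : P.T₁ + j ≤ P.T) :
    P.exploitWeight u ω η j = exp3Run (P.exploitGamma (P.numArms u ω)) (P.numArms u ω)
      (P.exploitReward u ω) (P.initWeight u ω) η j := by
  induction j with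
  | zero => rfl
  | succ j ih =>
    rw [exploitWeight, exp3Run, ← ih (by omega)]
    simp only [exp3Step, exploitArm, exploitReward]
    rw [if_pos ⟨by omega, sampleArm_lt hK _ _⟩]

lemma utility_exploitAction (hK : 1 ≤ P.numArms u ω) (η : ExploitSample) {j : ℕ}
    (hj : P.T₁ + j < P.T) :
    u (P.T₁ + j) (P.exploitAction u ω η j) = P.exploitReward u ω j
      (exp3RunArm (P.exploitGamma (P.numArms u ω)) (P.numArms u ω)
        (P.exploitReward u ω) (P.initWeight u ω) η j) (η j).2.1 := by
  have h : sampleArm (P.numArms u ω) (exp3Prob (P.exploitGamma (P.numArms u ω)) (P.numArms u ω)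
      (exp3Run (P.exploitGamma (P.numArms u ω)) (P.numArms u ω)
        (P.exploitReward u ω) (P.initWeight u ω) η j)) (η j).1 < P.numArms u ω :=
    sampleArm_lt hK _ _
  rw [exploitAction, exploitWeight_eq hK η hj.le, exploitReward, exp3RunArm, if_pos ⟨hj, h⟩,
    exploitArm]

/-! ### The regret of the whole run -/

lemma sum_utility_action (hT : P.T₁ ≤ P.T) (hK : 1 ≤ P.numArms u ω) (η : ExploitSample) :
    ∑ t ∈ Finset.range P.T, u t (P.action u ω η t) =
      ∑ t ∈ Finset.range P.T₁, u t (P.exploreAction ω t) +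
        ∑ j ∈ Finset.range (P.T - P.T₁), P.exploitReward u ω j
          (exp3RunArm (P.exploitGamma (P.numArms u ω)) (P.numArms u ω)
            (P.exploitReward u ω) (P.initWeight u ω) η j) (η j).2.1 := by
  conv_lhs => rw [← Nat.add_sub_cancel' hT, Finset.sum_range_add]
  congr 1
  · refine Finset.sum_congr rfl fun t ht => ?_
    rw [action, if_pos (Finset.mem_range.1 ht)]
  · refine Finset.sum_congr rfl fun j hj => ?_
    rw [action, if_neg (by omega), Nat.add_sub_cancel_left, utility_exploitAction hK]
    have := Finset.mem_range.1 hj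
    omega

lemma integrable_externalRegret (hU : 0 ≤ U) (hT : P.T₁ ≤ P.T)
    (hu : ∀ t < P.T, IsUtility L H U (u t)) (hK : 1 ≤ P.numArms u ω) (s : ℝ≥0) :
    Integrable (fun η => P.externalRegret u ω η) (exploitLaw s) ∧
      ∫ η, P.externalRegret u ω η ∂(exploitLaw s) =
        (⨆ x : unitInterval, ∑ t ∈ Finset.range P.T, u t x) -
          (∑ t ∈ Finset.range P.T₁, u t (P.exploreAction ω t) +
            ∑ j ∈ Finset.range (P.T - P.T₁), ∫ η, P.exploitReward u ω j
              (exp3RunArm (P.exploitGamma (P.numArms u ω)) (P.numArms u ω)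
                (P.exploitReward u ω) (P.initWeight u ω) η j) (η j).2.1 ∂(exploitLaw s)) := by
  have hri := fun j (_ : j ∈ Finset.range (P.T - P.T₁)) =>
    integrable_exp3Run_reward (P.exploitGamma (P.numArms u ω)) (P.numArms u ω)
    (measurable_exploitReward (ω := ω) hu) (abs_exploitReward_le hU hu) s (P.initWeight u ω) j
  have hsi := integrable_finsetSum _ hri
  have hai := (integrable_const (μ := exploitLaw s)
    (∑ t ∈ Finset.range P.T₁, u t (P.exploreAction ω t))).fun_add hsi
  simp only [externalRegret, sum_utility_action hT hK]
  refine ⟨(integrable_const _).sub hai, ?_⟩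
  rw [integral_sub (integrable_const _) hai, integral_add (integrable_const _) hsi,
    integral_finsetSum _ hri]
  simp

lemma iSup_sum_utility_le (hT : ∀ t < P.T, IsUtility L H U (u t)) :
    (⨆ x : unitInterval, ∑ t ∈ Finset.range P.T, u t x) ≤ P.T * U := by
  refine ciSup_le fun x => ?_
  refine (Finset.sum_le_card_nsmul _ _ U fun t ht => ?_).trans (by simp)
  exact (abs_le.1 ((hT t (Finset.mem_range.1 ht)).bounded x x.2)).2

lemma neg_le_sum_explore (hT : P.T₁ ≤ P.T) (hu : ∀ t < P.T, IsUtility L H U (u t))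
    (hω : P.IsGood B ω) :
    -(P.T₁ * U) ≤ ∑ t ∈ Finset.range P.T₁, u t (P.exploreAction ω t) := by
  have h := Finset.card_nsmul_le_sum (Finset.range P.T₁) (fun t => u t (P.exploreAction ω t)) (-U)
    fun t ht => (abs_le.1 ((hu t ((Finset.mem_range.1 ht).trans_le hT)).bounded _
      (samplePoint_mem (hω.arm_lt (Finset.mem_range.1 ht)) _))).1
  simpa using h

/-- The trivial bound for the regret. -/
lemma integral_externalRegret_le_trivial (hU : 0 ≤ U) (hT : P.T₁ ≤ P.T)
    (hu : ∀ t < P.T, IsUtility L H U (u t)) (hω : P.IsGood B ω) (hK : 1 ≤ P.numArms u ω)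
    (s : ℝ≥0) :
    ∫ η, P.externalRegret u ω η ∂(exploitLaw s) ≤ 2 * U * P.T := by
  rw [(integrable_externalRegret hU hT hu hK s).2]
  have h1 := iSup_sum_utility_le hu
  have h2 := neg_le_sum_explore hT hu hω
  have h3 : -((P.T - P.T₁ : ℝ) * U) ≤ ∑ j ∈ Finset.range (P.T - P.T₁), ∫ η, P.exploitReward u ω j
      (exp3RunArm (P.exploitGamma (P.numArms u ω)) (P.numArms u ω)
        (P.exploitReward u ω) (P.initWeight u ω) η j) (η j).2.1 ∂(exploitLaw s) := by
    have h := Finset.card_nsmul_le_sum (Finset.range (P.T - P.T₁)) (fun j =>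
      ∫ η, P.exploitReward u ω j (exp3RunArm (P.exploitGamma (P.numArms u ω)) (P.numArms u ω)
        (P.exploitReward u ω) (P.initWeight u ω) η j) (η j).2.1 ∂(exploitLaw s)) (-U)
      fun j _ => by
        have := norm_integral_le_of_norm_le_const (μ := exploitLaw s) (C := U)
          (f := fun η => P.exploitReward u ω j (exp3RunArm (P.exploitGamma (P.numArms u ω))
            (P.numArms u ω) (P.exploitReward u ω) (P.initWeight u ω) η j) (η j).2.1)
          (Filter.Eventually.of_forall fun η => abs_exploitReward_le hU hu _ _ _)
        rw [probReal_univ, mul_one] at this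
        exact (abs_le.1 this).1
    rw [Finset.card_range, nsmul_eq_mul, Nat.cast_sub hT] at h
    linarith
  linarith

/-- The EXP3 bound for the regret. -/
lemma integral_externalRegret_le (hL : 0 ≤ L) (hN : 1 ≤ P.N) (hU : 0 ≤ U) (hB : 0 ≤ B)
    (hγ0 : 0 < P.γ) (hγ1 : P.γ ≤ 1) (hT : P.T₁ ≤ P.T)
    (hu : ∀ t < P.T, IsUtility L H U (u t)) (hω : P.IsGood B ω) (hK : 1 ≤ P.numArms u ω)
    (s : ℝ≥0) (hg0 : 0 < P.exploitGamma (P.numArms u ω))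
    (hg1 : P.exploitGamma (P.numArms u ω) ≤ 1 / 2) :
    ∫ η, P.externalRegret u ω η ∂(exploitLaw s) ≤
      2 * U * P.T₁ + L * (P.T / P.numArms u ω) +
        P.numArms u ω / P.exploitGamma (P.numArms u ω) *
          (2 * (P.T₁ * (U + B)) + Real.log (P.numArms u ω)) +
        2 * P.exploitGamma (P.numArms u ω) * P.T * (U + rewardConst U s) := by
  rw [(integrable_externalRegret hU hT hu hK s).2, sub_le_iff_le_add]
  have hK' : (0 : ℝ) < P.numArms u ω := by exact_mod_cast hK
  have h2 := neg_le_sum_explore hT hu hω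
  refine ciSup_le fun x => ?_
  obtain ⟨i, hi, hcell⟩ := exists_cell hK x.2
  have hreg := exp3_regret hg0 hg1 hi (measurable_exploitReward (ω := ω) hu)
    (abs_exploitReward_le hU hu) s (initWeight_pos hN hK) (P.T - P.T₁)
  have hinit := mul_le_mul_of_nonneg_left
    (neg_logShare_initWeight_le hN (add_nonneg hU hB) hγ0 hγ1 hT hu hω hK i)
    (div_nonneg hK'.le hg0.le)
  have hn : ((P.T - P.T₁ : ℕ) : ℝ) ≤ P.T := by exact_mod_cast Nat.sub_le _ _
  have hstep : 2 * P.exploitGamma (P.numArms u ω) * ((P.T - P.T₁ : ℕ) : ℝ) *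
      (U + rewardConst U s) ≤
      2 * P.exploitGamma (P.numArms u ω) * P.T * (U + rewardConst U s) := by
    have := rewardConst_nonneg U s
    gcongr
  have hx1 : ∑ t ∈ Finset.range P.T₁, u t x ≤ P.T₁ * U := by
    refine (Finset.sum_le_card_nsmul _ _ U fun t ht => ?_).trans (by simp)
    exact (abs_le.1 ((hu t ((Finset.mem_range.1 ht).trans_le hT)).bounded x x.2)).2
  -- Discretization: every point of the cell of `x` is within `1 / numArms` of `x`, so the mean
  -- reward of that arm loses at most `L / numArms` per round.
  have hx2 : ∑ j ∈ Finset.range (P.T - P.T₁), u (P.T₁ + j) x ≤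
      ∑ j ∈ Finset.range (P.T - P.T₁), (∫ y, P.exploitReward u ω j i y) +
        L * (P.T / P.numArms u ω) := by
    have hj : ∀ j ∈ Finset.range (P.T - P.T₁), u (P.T₁ + j) x ≤
        (∫ y, P.exploitReward u ω j i y) + L * (1 / P.numArms u ω) := by
      intro j hj
      have hjT : P.T₁ + j < P.T := by
        have := Finset.mem_range.1 hj
        omega
      have hInt := integrable_of_abs_le (measurable_exploitReward (ω := ω) hu j i)
        (abs_exploitReward_le hU hu j i)
      have hpt : ∀ y, u (P.T₁ + j) x - L * (1 / P.numArms u ω) ≤ P.exploitReward u ω j i y := by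
        intro y
        rw [exploitReward, if_pos ⟨hjT, hi⟩]
        have h1 := (le_abs_self _).trans
          ((hu _ hjT).lipschitz x x.2 _ (samplePoint_mem hi y))
        have h2 := mul_le_mul_of_nonneg_left (hcell y) hL
        linarith
      have := integral_mono (integrable_const _) hInt hpt
      rw [integral_const] at this
      simp only [probReal_univ, one_smul] at this
      linarith
    refine (Finset.sum_le_sum hj).trans ?_
    rw [Finset.sum_add_distrib, Finset.sum_const, Finset.card_range, nsmul_eq_mul]
    have h3 : ((P.T - P.T₁ : ℕ) : ℝ) * (L * (1 / P.numArms u ω)) ≤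
        P.T * (L * (1 / P.numArms u ω)) := by gcongr
    have h4 : (P.T : ℝ) * (L * (1 / P.numArms u ω)) = L * (P.T / P.numArms u ω) := by ring
    linarith
  have hsplit : ∑ t ∈ Finset.range P.T, u t x = ∑ t ∈ Finset.range P.T₁, u t x +
      ∑ j ∈ Finset.range (P.T - P.T₁), u (P.T₁ + j) x := by
    conv_lhs => rw [← Nat.add_sub_cancel' hT, Finset.sum_range_add]
  rw [hsplit]
  linarith

/-- For a utility function that does not change, the two notions of regret agree. -/
lemma cumulativeRegret_eq_externalRegret (hu : ∀ t < P.T, EqOn (u t) (u 0) (Icc 0 1))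
    (η : ExploitSample) : P.cumulativeRegret u ω η = P.externalRegret u ω η := by
  have h1 : ∀ t ∈ Finset.range P.T, (⨆ x : unitInterval, u t x) = ⨆ x : unitInterval, u 0 x :=
    fun t ht => iSup_congr fun x => hu t (Finset.mem_range.1 ht) x.2
  have h2 : ∀ x : unitInterval, ∑ t ∈ Finset.range P.T, u t x = P.T * u 0 x := fun x => by
    rw [Finset.sum_congr rfl fun t ht => hu t (Finset.mem_range.1 ht) x.2]
    simp
  rw [cumulativeRegret, externalRegret, Finset.sum_sub_distrib, Finset.sum_congr rfl h1,
    iSup_congr h2, ← Real.mul_iSup_of_nonneg (Nat.cast_nonneg _)]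
  simp

end Params

/-! ### The probability of a good exploration -/

/-- Chernoff with parameters `1` and `-1`; decay like `exp (-B)` is enough for a threshold
logarithmic in `T`. -/
lemma gaussianReal_abs_gt_le (s : ℝ≥0) (B : ℝ) :
    (gaussianReal 0 s).real {x | B < |x|} ≤ 2 * Real.exp (s / 2 - B) := by
  have hm : ∀ t : ℝ, mgf (fun x : ℝ => x) (gaussianReal 0 s) t = Real.exp (s * t ^ 2 / 2) := fun t => by
    have := congrFun (mgf_id_gaussianReal (μ := 0) (v := s)) t
    simpa [mgf] using this
  have h1 := measure_ge_le_exp_mul_mgf (μ := gaussianReal 0 s) (X := fun x : ℝ => x) (t := 1) B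
    zero_le_one (integrable_exp_mul_gaussianReal 1)
  have h2 := measure_le_le_exp_mul_mgf (μ := gaussianReal 0 s) (X := fun x : ℝ => x) (t := -1) (-B)
    (by norm_num) (integrable_exp_mul_gaussianReal (-1))
  rw [hm, ← Real.exp_add] at h1 h2
  have hsub : {x : ℝ | B < |x|} ⊆ {x | B ≤ x} ∪ {x | x ≤ -B} := fun x hx => by
    rcases lt_abs.1 (show B < |x| from hx) with h | h
    · exact Or.inl h.le
    · exact Or.inr (show x ≤ -B by linarith)
  have h3 := (measureReal_mono (μ := gaussianReal 0 s) hsub).trans (measureReal_union_le _ _)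
  have e1 : -1 * B + (s : ℝ) * 1 ^ 2 / 2 = s / 2 - B := by ring
  have e2 : -(-1) * -B + (s : ℝ) * (-1) ^ 2 / 2 = s / 2 - B := by ring
  rw [e1] at h1
  rw [e2] at h2
  linarith

lemma isProbabilityMeasure_exploreLaw {ν : Measure (ℕ → ℕ)} [IsProbabilityMeasure ν] (s : ℝ≥0) :
    IsProbabilityMeasure (exploreLaw ν s) := by
  unfold exploreLaw
  infer_instance

lemma measurePreserving_exploreNoise (ν : Measure (ℕ → ℕ)) [IsProbabilityMeasure ν] (s : ℝ≥0)
    (t : ℕ) : MeasurePreserving (fun ω : ExploreSample => (ω.2 t).2) (exploreLaw ν s)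
      (gaussianReal 0 s) :=
  (measurePreserving_snd (μ := (volume : Measure unitInterval))).comp
    ((measurePreserving_eval_infinitePi (fun _ : ℕ => rewardLaw s) t).comp
      (measurePreserving_snd (μ := ν)))

namespace Params

lemma measurableSet_isGood (P : Params) (B : ℝ) : MeasurableSet {ω | P.IsGood B ω} := by
  simp only [IsGood, ofPred_and, ofPred_forall]
  refine MeasurableSet.inter (MeasurableSet.iInter fun n => MeasurableSet.iInter fun _ => ?_)
    (MeasurableSet.iInter fun t => MeasurableSet.iInter fun _ => ?_)
  · have h : Measurable fun ω : ExploreSample =>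
        ∑ t ∈ Finset.range (P.A * P.N), if ω.1 t = n then 1 else 0 := by
      refine Finset.measurable_sum _ fun t _ => ?_
      refine Measurable.ite (measurableSet_eq_fun ?_ measurable_const) measurable_const
        measurable_const
      exact (measurable_pi_apply t).comp measurable_fst
    simp only [Finset.card_filter]
    exact measurableSet_eq_fun h measurable_const
  · have h : Measurable fun ω : ExploreSample => |(ω.2 t).2| := by fun_prop
    exact measurableSet_le h measurable_const

/-- A union bound over the `A * N` noises; the condition on the order fails only on a null set. -/
lemma measure_isGood_ge (P : Params) {ν : Measure (ℕ → ℕ)} (hν : IsUniformExploration P.N P.A ν)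
    (s : ℝ≥0) (B : ℝ) :
    1 - P.A * P.N * (2 * Real.exp (s / 2 - B)) ≤ (exploreLaw ν s).real {ω | P.IsGood B ω} := by
  have := hν.1
  have := isProbabilityMeasure_exploreLaw (ν := ν) s
  have hord : ∀ᵐ ω ∂(exploreLaw ν s),
      ∀ n < P.N, ((Finset.range (P.A * P.N)).filter fun t => ω.1 t = n).card = P.A :=
    (Measure.quasiMeasurePreserving_fst (μ := ν)).ae hν.2
  have hsub : {ω | P.IsGood B ω}ᶜ ⊆
      {ω : ExploreSample |
        ¬ ∀ n < P.N, ((Finset.range (P.A * P.N)).filter fun t => ω.1 t = n).card = P.A} ∪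
      ⋃ t ∈ Finset.range (P.A * P.N), {ω : ExploreSample | B < |(ω.2 t).2|} := by
    intro ω hω
    by_cases h : ∀ n < P.N, ((Finset.range (P.A * P.N)).filter fun t => ω.1 t = n).card = P.A
    · right
      by_contra hcon
      refine hω ⟨h, fun t ht => ?_⟩
      by_contra hlt
      exact hcon (mem_biUnion (Finset.mem_coe.2 (Finset.mem_range.2 ht)) (not_le.1 hlt))
    · exact Or.inl h
  have hnoise : ∀ t, (exploreLaw ν s).real {ω : ExploreSample | B < |(ω.2 t).2|} ≤
      2 * Real.exp (s / 2 - B) := by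
    intro t
    have hms : MeasurableSet {x : ℝ | B < |x|} := measurableSet_lt measurable_const (by fun_prop)
    have := (measurePreserving_exploreNoise ν s t).measureReal_preimage hms.nullMeasurableSet
    exact this.le.trans (gaussianReal_abs_gt_le s B)
  have h0 : (exploreLaw ν s).real {ω : ExploreSample |
      ¬ ∀ n < P.N, ((Finset.range (P.A * P.N)).filter fun t => ω.1 t = n).card = P.A} = 0 := by
    rw [measureReal_def, ae_iff.1 hord, ENNReal.toReal_zero]
  have hle : (exploreLaw ν s).real {ω | P.IsGood B ω}ᶜ ≤
      P.A * P.N * (2 * Real.exp (s / 2 - B)) := by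
    refine (measureReal_mono hsub).trans ((measureReal_union_le _ _).trans ?_)
    rw [h0, zero_add]
    refine (measureReal_biUnion_finset_le _ _).trans ?_
    refine (Finset.sum_le_card_nsmul _ _ _ fun t _ => hnoise t).trans (le_of_eq ?_)
    rw [Finset.card_range, nsmul_eq_mul, Nat.cast_mul]
  rw [probReal_compl_eq_one_sub (P.measurableSet_isGood B)] at hle
  linarith

end Params

/-! ### Orders of magnitude -/

/-- Either the horizon is small, or the learning rate of EXP3 is small and the two terms of the
regret bound are controlled. Here `x = T ^ (1 / 24)`. -/
lemma exploitGamma_cases {P : Params} {K : ℕ} {x c k₁ k₂ : ℝ} (hx : 1 ≤ x) (hT : (P.T : ℝ) = x ^ 24)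
    (hc : 0 < c) (hk₁ : 1 ≤ k₁) (hk₂ : 1 ≤ k₂) (hlo : c * x ^ 8 ≤ K) (hup : K ≤ k₁ * x ^ 10)
    (hlog : Real.log K ≤ k₂ * x ^ 2) :
    (P.T : ℝ) ≤ (1 / c + 4 * k₁ * k₂) * x ^ 20 ∨
      (0 < P.exploitGamma K ∧ P.exploitGamma K ≤ 1 / 2 ∧
        K / P.exploitGamma K ≤ 2 * k₁ * x ^ 17 ∧ P.exploitGamma K * P.T ≤ k₁ * k₂ * x ^ 18) := by
  have hx0 : 0 < x := by linarith
  have hKpos : (0 : ℝ) < K := lt_of_lt_of_le (by positivity) hlo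
  have hK1 : 1 ≤ K := by exact_mod_cast hKpos
  have hTpos : (0 : ℝ) < P.T := by rw [hT]; positivity
  have hlog0 : 0 ≤ Real.log K := Real.log_nonneg (by exact_mod_cast hK1)
  have he1 : 1 ≤ Real.exp 1 - 1 := by linarith [Real.add_one_le_exp (1 : ℝ)]
  have he2 : Real.exp 1 - 1 ≤ 2 := by linarith [Real.exp_one_lt_d9]
  have hKlog : K * Real.log K ≤ k₁ * k₂ * x ^ 12 := by
    calc K * Real.log K ≤ (k₁ * x ^ 10) * (k₂ * x ^ 2) :=
          mul_le_mul hup hlog hlog0 (by positivity)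
      _ = k₁ * k₂ * x ^ 12 := by ring
  -- For `K = 1` the tuning degenerates to `γ = 0`, but then `c * x ^ 8 ≤ 1` bounds the horizon.
  rcases Nat.lt_or_ge K 2 with hK2 | hK2
  · left
    have hK : K = 1 := by omega
    rw [hK, Nat.cast_one] at hlo
    have h1 : x ^ 8 ≤ 1 / c := by rw [le_div_iff₀ hc]; linarith
    have h2 : x ^ 16 ≤ x ^ 20 := pow_le_pow_right₀ hx (by norm_num)
    calc (P.T : ℝ) = x ^ 8 * x ^ 16 := by rw [hT]; ring
      _ ≤ 1 / c * x ^ 20 := by gcongr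
      _ ≤ (1 / c + 4 * k₁ * k₂) * x ^ 20 := by
        gcongr
        have : 0 ≤ 4 * k₁ * k₂ := by positivity
        linarith
  have hlog2 : 1 / 2 ≤ Real.log K := by
    have h1 : Real.log 2 ≤ Real.log K := Real.log_le_log (by norm_num) (by exact_mod_cast hK2)
    linarith [Real.log_two_gt_d9]
  set Q := K * Real.log K / ((Real.exp 1 - 1) * P.T) with hQ
  have hQpos : 0 < Q := by positivity
  have hg : P.exploitGamma K = min 1 (Real.sqrt Q) := rfl
  rcases le_or_gt (P.exploitGamma K) (1 / 2) with hγ | hγ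
  · right
    have hgs : P.exploitGamma K = Real.sqrt Q := by
      rw [hg] at hγ ⊢
      rcases min_le_iff.1 hγ with h | h
      · norm_num at h
      · exact min_eq_right (by linarith)
    have hg0 : 0 < P.exploitGamma K := hgs ▸ Real.sqrt_pos.2 hQpos
    have hgsq : P.exploitGamma K ^ 2 = Q := by rw [hgs, Real.sq_sqrt hQpos.le]
    refine ⟨hg0, hγ, ?_, ?_⟩
    · refine (le_abs_self _).trans (abs_le_of_sq_le_sq ?_ (by positivity))
      have h1 : (K / P.exploitGamma K) ^ 2 = K * (Real.exp 1 - 1) * P.T / Real.log K := by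
        rw [div_pow, hgsq, hQ]
        field_simp
      rw [h1, div_le_iff₀ (by linarith)]
      calc K * (Real.exp 1 - 1) * P.T ≤ (k₁ * x ^ 10) * 2 * x ^ 24 := by
            rw [hT]
            gcongr
        _ = k₁ * (2 * x ^ 34) := by ring
        _ ≤ k₁ ^ 2 * (2 * x ^ 34) := by
            gcongr
            nlinarith
        _ = (2 * k₁ * x ^ 17) ^ 2 * (1 / 2) := by ring
        _ ≤ (2 * k₁ * x ^ 17) ^ 2 * Real.log K := by gcongr
    · refine (le_abs_self _).trans (abs_le_of_sq_le_sq ?_ (by positivity))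
      rw [mul_pow, hgsq]
      have hk : 1 ≤ k₁ * k₂ := one_le_mul_of_one_le_of_one_le hk₁ hk₂
      calc Q * (P.T : ℝ) ^ 2 = K * Real.log K * P.T / (Real.exp 1 - 1) := by
            rw [hQ]
            field_simp
        _ ≤ K * Real.log K * P.T := div_le_self (by positivity) he1
        _ ≤ k₁ * k₂ * x ^ 12 * x ^ 24 := by
            rw [hT]
            gcongr
        _ = (k₁ * k₂) * x ^ 36 := by ring
        _ ≤ (k₁ * k₂) ^ 2 * x ^ 36 := by
            gcongr
            nlinarith
        _ = (k₁ * k₂ * x ^ 18) ^ 2 := by ring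
  · left
    have h1 : 1 / 2 < Real.sqrt Q := lt_of_lt_of_le hγ (by rw [hg]; exact min_le_right _ _)
    -- A large learning rate means that `T` is less than a multiple of `K * log K`, hence `O(x ^
    -- 12)`.
    have h2 : 1 / 4 < Q := by
      have := (Real.lt_sqrt (by norm_num)).1 h1
      linarith
    rw [hQ, lt_div_iff₀ (by positivity)] at h2
    have h3 : (P.T : ℝ) ≤ (Real.exp 1 - 1) * P.T := le_mul_of_one_le_left hTpos.le he1
    have h4 : x ^ 12 ≤ x ^ 20 := pow_le_pow_right₀ hx (by norm_num)
    calc (P.T : ℝ) ≤ 4 * (k₁ * k₂ * x ^ 12) := by linarith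
      _ = 4 * k₁ * k₂ * x ^ 12 := by ring
      _ ≤ (1 / c + 4 * k₁ * k₂) * x ^ 20 := by
        gcongr
        have : 0 < 1 / c := by positivity
        linarith

/-- Logarithms of `T` are absorbed into `x ^ 2`; the exponent `5/6` leaves room for this. -/
lemma log_le_sq {x : ℝ} (hx : 1 ≤ x) : Real.log x ≤ x ^ 2 := by
  have := Real.log_le_sub_one_of_pos (by linarith : 0 < x)
  nlinarith

lemma rpow_two_thirds_le {y : ℝ} (hy : 0 ≤ y) : y ^ (2 / 3 : ℝ) ≤ 1 + y := by
  rcases le_total y 1 with h | h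
  · linarith [Real.rpow_le_one hy h (by norm_num : (0 : ℝ) ≤ 2 / 3)]
  · have := Real.rpow_le_rpow_of_exponent_le h (by norm_num : (2 / 3 : ℝ) ≤ 1)
    rw [Real.rpow_one] at this
    linarith

lemma sqrt_le_one_add {z : ℝ} (hz : 0 ≤ z) : Real.sqrt z ≤ 1 + z :=
  Real.sqrt_le_iff.2 ⟨by linarith, by nlinarith⟩

/-! ### Size of the Lipschitz estimate, number of arms and final regret bound -/

namespace Params

variable {P : Params} {L H U B : ℝ} {u : ℕ → ℝ → ℝ} {ω : ExploreSample}

/-- The confidence term alone keeps the estimate away from `0`, uniformly in `T`. This forces at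
least order `T ^ (1/3)` arms. -/
lemma lipTilde_ge (P : Params) (u : ℕ → ℝ → ℝ) (ω : ExploreSample) (hN : 1 ≤ P.N) (hT : 1 ≤ P.T) :
    Real.sqrt (2 / P.A * Real.log 2) ≤ P.lipTilde u ω := by
  have hN' : (1 : ℝ) ≤ P.N := by exact_mod_cast hN
  have hT' : (1 : ℝ) ≤ P.T := by exact_mod_cast hT
  have h1 : Real.sqrt (2 / P.A * Real.log 2) ≤
      Real.sqrt (2 / P.A * Real.log (2 * P.N * P.T)) := by
    refine Real.sqrt_le_sqrt (mul_le_mul_of_nonneg_left ?_ (by positivity))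
    refine Real.log_le_log two_pos ?_
    nlinarith
  have h2 := P.lipHat_nonneg u ω
  have h3 : Real.sqrt (2 / P.A * Real.log (2 * P.N * P.T)) ≤
      P.N * Real.sqrt (2 / P.A * Real.log (2 * P.N * P.T)) :=
    le_mul_of_one_le_left (Real.sqrt_nonneg _) hN'
  rw [lipTilde]
  linarith

lemma lipTilde_le (hA : 1 ≤ P.A) (hN : 1 ≤ P.N) (hT : P.T₁ ≤ P.T)
    (hu : ∀ t < P.T, IsUtility L H U (u t)) (hω : P.IsGood B ω) {x b : ℝ} (hx : 1 ≤ x)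
    (hTx : (P.T : ℝ) = x ^ 24) (hb : U + B ≤ b * x ^ 2) :
    P.lipTilde u ω ≤ P.N * (2 * b + 1 + 2 * (Real.log (2 * P.N) + 24)) * x ^ 2 := by
  have hA' : (1 : ℝ) ≤ P.A := by exact_mod_cast hA
  have hN' : (1 : ℝ) ≤ P.N := by exact_mod_cast hN
  have hx2 : 1 ≤ x ^ 2 := one_le_pow₀ hx
  have hlogN : 0 ≤ Real.log (2 * P.N) := Real.log_nonneg (by linarith)
  have hlog : Real.log (2 * P.N * P.T) = Real.log (2 * P.N) + 24 * Real.log x := by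
    rw [hTx, Real.log_mul (by positivity) (by positivity), Real.log_pow]
    norm_num
  have hlx := log_le_sq hx
  have hlx0 := Real.log_nonneg hx
  have hlog' : Real.log (2 * P.N * P.T) ≤ (Real.log (2 * P.N) + 24) * x ^ 2 := by
    rw [hlog]
    nlinarith
  have hlog0 : 0 ≤ Real.log (2 * P.N * P.T) := by
    rw [hlog]
    positivity
  have h2A : 2 / (P.A : ℝ) ≤ 2 := div_le_self zero_le_two hA'
  have hsqrt : Real.sqrt (2 / P.A * Real.log (2 * P.N * P.T)) ≤
      (1 + 2 * (Real.log (2 * P.N) + 24)) * x ^ 2 := by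
    refine (sqrt_le_one_add (by positivity)).trans ?_
    have := mul_le_mul h2A hlog' hlog0 zero_le_two
    linarith
  have h1 := lipHat_le hA hN hT hu hω
  have h2 := mul_le_mul_of_nonneg_left hsqrt (by linarith : (0 : ℝ) ≤ P.N)
  have h3 := mul_le_mul_of_nonneg_left hb (by linarith : (0 : ℝ) ≤ P.N)
  rw [lipTilde]
  linarith

lemma numArms_bounds (P : Params) (u : ℕ → ℝ → ℝ) (ω : ExploreSample) (hN : 1 ≤ P.N) {x : ℝ}
    (hx : 1 ≤ x) (hTx : (P.T : ℝ) = x ^ 24) :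
    P.lipTilde u ω ^ (2 / 3 : ℝ) * x ^ 8 ≤ P.numArms u ω ∧
      (0 ≤ P.lipTilde u ω →
        P.numArms u ω ≤ P.lipTilde u ω ^ (2 / 3 : ℝ) * x ^ 8 + P.N) := by
  have hN' : (0 : ℝ) < P.N := by exact_mod_cast hN
  have hx0 : 0 ≤ x := by linarith
  have hroot : (P.T : ℝ) ^ (1 / 3 : ℝ) = x ^ 8 := by
    rw [hTx, ← Real.rpow_natCast, ← Real.rpow_mul hx0, ← Real.rpow_natCast]
    norm_num
  rw [numArms, hroot]
  push_cast
  constructor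
  · have := Nat.le_ceil (P.lipTilde u ω ^ (2 / 3 : ℝ) * x ^ 8 / P.N)
    rwa [div_le_iff₀' hN'] at this
  · intro h0
    have := (Nat.ceil_lt_add_one
      (by positivity : 0 ≤ P.lipTilde u ω ^ (2 / 3 : ℝ) * x ^ 8 / P.N)).le
    have h1 := mul_le_mul_of_nonneg_left this hN'.le
    rwa [mul_add, mul_div_cancel₀ _ hN'.ne', mul_one] at h1

/-- The regret bound on a good exploration; the constant depends only on the parameters of the
problem. Here `x = T ^ (1 / 24)`. -/
lemma exists_integral_externalRegret_le (hL : 0 ≤ L) (hU : 0 ≤ U) (s : ℝ≥0) (N A : ℕ) (hN : 1 ≤ N)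
    (hA : 1 ≤ A) {b : ℝ} (hb : 0 ≤ b) :
    ∃ C : ℝ, ∀ (P : Params), P.N = N → P.A = A → P.T₁ ≤ P.T → 0 < P.γ → P.γ ≤ 1 →
      ∀ u : ℕ → ℝ → ℝ, (∀ t < P.T, IsUtility L H U (u t)) →
      ∀ x : ℝ, 1 ≤ x → (P.T : ℝ) = x ^ 24 → ∀ B : ℝ, 0 ≤ B → U + B ≤ b * x ^ 2 →
      ∀ ω, P.IsGood B ω → 1 ≤ P.numArms u ω ∧
        ∫ η, P.externalRegret u ω η ∂(exploitLaw s) ≤ C * x ^ 20 := by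
  have hN' : (1 : ℝ) ≤ N := by exact_mod_cast hN
  have hA' : (1 : ℝ) ≤ A := by exact_mod_cast hA
  have hlogN : 0 ≤ Real.log (2 * N) := Real.log_nonneg (by linarith)
  -- The constants control `lipTilde ≤ l₁ * x ^ 2`, `K ≤ k₁ * x ^ 10`, `log K ≤ k₂ * x ^ 2` and,
  -- from below, `K ≥ c * x ^ 8`.
  obtain ⟨l₁, hl₁⟩ : ∃ l₁ : ℝ, l₁ = N * (2 * b + 1 + 2 * (Real.log (2 * N) + 24)) := ⟨_, rfl⟩
  have hl₁0 : 0 ≤ l₁ := by rw [hl₁]; positivity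
  obtain ⟨k₁, hk₁⟩ : ∃ k₁ : ℝ, k₁ = 1 + l₁ + N := ⟨_, rfl⟩
  have hk₁1 : 1 ≤ k₁ := by linarith
  obtain ⟨k₂, hk₂⟩ : ∃ k₂ : ℝ, k₂ = Real.log k₁ + 10 := ⟨_, rfl⟩
  have hk₂1 : 1 ≤ k₂ := by linarith [Real.log_nonneg hk₁1]
  have hl₀ : 0 < Real.sqrt (2 / A * Real.log 2) :=
    Real.sqrt_pos.2 (mul_pos (by positivity) (Real.log_pos one_lt_two))
  obtain ⟨c, hc⟩ : ∃ c : ℝ, c = Real.sqrt (2 / A * Real.log 2) ^ (2 / 3 : ℝ) := ⟨_, rfl⟩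
  have hc0 : 0 < c := by rw [hc]; positivity
  have hR := rewardConst_nonneg U s
  -- The first summand serves short horizons via the trivial bound; the others match the four terms
  -- of the EXP3 bound.
  refine ⟨2 * U * (1 / c + 4 * k₁ * k₂) + (2 * U * (A * N) + L * (1 / c) +
    2 * k₁ * (2 * (A * N * b) + k₂) + 2 * (k₁ * k₂) * (U + rewardConst U s)), ?_⟩
  rintro P rfl rfl hT hγ0 hγ1 u hu x hx hTx B hB hBb ω hω
  have hx0 : 0 < x := by linarith
  have hT1 : 1 ≤ P.T := by
    have : (1 : ℝ) ≤ P.T := by rw [hTx]; exact one_le_pow₀ hx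
    exact_mod_cast this
  have hlt := lipTilde_le hA hN hT hu hω hx hTx hBb
  rw [← hl₁] at hlt
  have hge := P.lipTilde_ge u ω hN hT1
  have hlip0 : 0 ≤ P.lipTilde u ω := hl₀.le.trans hge
  obtain ⟨hlo, hup⟩ := P.numArms_bounds u ω hN hx hTx
  replace hup := hup hlip0
  have hlo' : c * x ^ 8 ≤ P.numArms u ω := by
    refine le_trans (mul_le_mul_of_nonneg_right ?_ (by positivity)) hlo
    rw [hc]
    exact Real.rpow_le_rpow hl₀.le hge (by norm_num)
  have hup' : P.numArms u ω ≤ k₁ * x ^ 10 := by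
    refine hup.trans ?_
    have h1 : P.lipTilde u ω ^ (2 / 3 : ℝ) ≤ (1 + l₁) * x ^ 2 := by
      refine (rpow_two_thirds_le hlip0).trans ?_
      linarith [one_le_pow₀ hx (n := 2)]
    have h2 := mul_le_mul_of_nonneg_right h1 (by positivity : 0 ≤ x ^ 8)
    have h3 : (P.N : ℝ) ≤ P.N * x ^ 10 := le_mul_of_one_le_right (by linarith) (one_le_pow₀ hx)
    rw [hk₁]
    linarith
  have hKpos : (0 : ℝ) < P.numArms u ω := lt_of_lt_of_le (by positivity) hlo'
  have hK1 : 1 ≤ P.numArms u ω := by exact_mod_cast hKpos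
  have hlog : Real.log (P.numArms u ω) ≤ k₂ * x ^ 2 := by
    refine (Real.log_le_log hKpos hup').trans ?_
    rw [Real.log_mul (by positivity) (by positivity), Real.log_pow, hk₂]
    have h1 := log_le_sq hx
    have h2 : Real.log k₁ ≤ Real.log k₁ * x ^ 2 :=
      le_mul_of_one_le_right (Real.log_nonneg hk₁1) (one_le_pow₀ hx)
    push_cast
    linarith
  refine ⟨hK1, ?_⟩
  have hmain : 0 ≤ 2 * U * (P.A * P.N) + L * (1 / c) +
      2 * k₁ * (2 * (P.A * P.N * b) + k₂) + 2 * (k₁ * k₂) * (U + rewardConst U s) := by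
    positivity
  rcases exploitGamma_cases hx hTx hc0 hk₁1 hk₂1 hlo' hup' hlog with h | ⟨hg0, hg1, hg2, hg3⟩
  · refine (integral_externalRegret_le_trivial hU hT hu hω hK1 s).trans ?_
    have h1 := mul_le_mul_of_nonneg_left h (by positivity : 0 ≤ 2 * U)
    have h2 := mul_nonneg hmain (by positivity : 0 ≤ x ^ 20)
    linarith
  · refine (integral_externalRegret_le hL hN hU hB hγ0 hγ1 hT hu hω hK1 s hg0 hg1).trans ?_
    have hT₁ : (P.T₁ : ℝ) = P.A * P.N := by rw [T₁]; push_cast; ring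
    have e1 : 2 * U * (P.T₁ : ℝ) ≤ 2 * U * (P.A * P.N) * x ^ 20 := by
      rw [hT₁]
      exact le_mul_of_one_le_right (by positivity) (one_le_pow₀ hx)
    have e2 : L * ((P.T : ℝ) / P.numArms u ω) ≤ L * (1 / c) * x ^ 20 := by
      rw [mul_assoc]
      refine mul_le_mul_of_nonneg_left ?_ hL
      rw [div_le_iff₀ hKpos, hTx]
      calc x ^ 24 ≤ x ^ 28 := pow_le_pow_right₀ hx (by norm_num)
        _ = 1 / c * x ^ 20 * (c * x ^ 8) := by field_simp
        _ ≤ 1 / c * x ^ 20 * P.numArms u ω := by gcongr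
    have e3 : P.numArms u ω / P.exploitGamma (P.numArms u ω) *
        (2 * (P.T₁ * (U + B)) + Real.log (P.numArms u ω)) ≤
        2 * k₁ * (2 * (P.A * P.N * b) + k₂) * x ^ 20 := by
      have h1 : 2 * (P.T₁ * (U + B)) + Real.log (P.numArms u ω) ≤
          (2 * (P.A * P.N * b) + k₂) * x ^ 2 := by
        have := mul_le_mul_of_nonneg_left hBb (by positivity : 0 ≤ (P.A : ℝ) * P.N)
        rw [hT₁]
        linarith
      have h0 : 0 ≤ 2 * (P.T₁ * (U + B)) + Real.log (P.numArms u ω) :=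
        add_nonneg (by positivity) (Real.log_nonneg (by exact_mod_cast hK1))
      -- This is the largest term: the price `O(x ^ 2)` of the initial weights times `K / γ`.
      calc _ ≤ (2 * k₁ * x ^ 17) * ((2 * (P.A * P.N * b) + k₂) * x ^ 2) :=
            mul_le_mul hg2 h1 h0 (by positivity)
        _ = 2 * k₁ * (2 * (P.A * P.N * b) + k₂) * x ^ 19 := by ring
        _ ≤ 2 * k₁ * (2 * (P.A * P.N * b) + k₂) * x ^ 20 := by
            have := pow_le_pow_right₀ hx (by norm_num : 19 ≤ 20)
            gcongr
    have e4 : 2 * P.exploitGamma (P.numArms u ω) * P.T * (U + rewardConst U s) ≤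
        2 * (k₁ * k₂) * (U + rewardConst U s) * x ^ 20 := by
      have h1 : k₁ * k₂ * x ^ 18 ≤ k₁ * k₂ * x ^ 20 :=
        mul_le_mul_of_nonneg_left (pow_le_pow_right₀ hx (by norm_num)) (by positivity)
      have h2 := mul_le_mul_of_nonneg_right (hg3.trans h1)
        (by positivity : 0 ≤ 2 * (U + rewardConst U s))
      linarith
    have e5 : 0 ≤ 2 * U * (1 / c + 4 * k₁ * k₂) * x ^ 20 := by positivity
    linarith

end Params

end LipschitzBandit

end

/-! ### The regret bound with probability at least `1 - 1/T` -/

open LipschitzBandit in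
theorem proposition7 (L H U : ℝ) (hL : 0 < L) (s : ℝ≥0) (N A : ℕ) (hN : 1 ≤ N)
    (hNH : 8 * H / L ≤ (N : ℝ)) (hA : 1 ≤ A) :
    ∃ (C : ℝ) (k : ℕ), ∀ T : ℕ, A * N ≤ T → ∀ γ : ℝ, 0 < γ → γ ≤ 1 →
      ∀ u : ℕ → ℝ → ℝ, (∀ t < T, LipschitzBandit.IsUtility L H U (u t)) →
      ∀ ν : Measure (ℕ → ℕ), LipschitzBandit.IsUniformExploration N A ν →
      ∃ E : Set LipschitzBandit.ExploreSample, MeasurableSet E ∧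
        ENNReal.ofReal (1 - 1 / (T : ℝ)) ≤ LipschitzBandit.exploreLaw ν s E ∧
        ∀ ω ∈ E,
          (Integrable (fun η => LipschitzBandit.Params.externalRegret ⟨N, A, T, γ⟩ u ω η)
              (LipschitzBandit.exploitLaw s) ∧
            ∫ η, LipschitzBandit.Params.externalRegret ⟨N, A, T, γ⟩ u ω η
                ∂(LipschitzBandit.exploitLaw s)
              ≤ C * (T : ℝ) ^ (5 / 6 : ℝ) * Real.log T ^ k) ∧
          ((∀ t < T, Set.EqOn (u t) (u 0) (Set.Icc 0 1)) →
            Integrable (fun η => LipschitzBandit.Params.cumulativeRegret ⟨N, A, T, γ⟩ u ω η)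
              (LipschitzBandit.exploitLaw s) ∧
            ∫ η, LipschitzBandit.Params.cumulativeRegret ⟨N, A, T, γ⟩ u ω η
                ∂(LipschitzBandit.exploitLaw s)
              ≤ C * (T : ℝ) ^ (5 / 6 : ℝ) * Real.log T ^ k) := by
  have hN' : (1 : ℝ) ≤ N := by exact_mod_cast hN
  have hA' : (1 : ℝ) ≤ A := by exact_mod_cast hA
  have hANT : ∀ T, A * N ≤ T → 1 ≤ T := fun T h => (Nat.mul_pos hA hN).trans_le h
  rcases lt_or_ge U 0 with hU | hU
  -- For `U < 0` there is no utility function, and round `0` exists because `T ≥ 1`.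
  · refine ⟨0, 0, fun T hT γ _ _ u hu => ?_⟩
    have := (abs_nonneg _).trans ((hu 0 (hANT T hT)).bounded 0 ⟨le_rfl, zero_le_one⟩)
    linarith
  have hAN : 1 ≤ 2 * (A * N : ℝ) := by nlinarith
  have hlogAN : 0 ≤ Real.log (2 * (A * N)) := Real.log_nonneg hAN
  obtain ⟨C, hC⟩ := Params.exists_integral_externalRegret_le (H := H) hL.le hU s N A hN hA
    (b := U + (s / 2 + Real.log (2 * (A * N)) + 24)) (by positivity)
  -- No logarithm is left over, so `k = 0`. This also covers `T = 1`, where a positive power of `log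
  -- T` would vanish.
  refine ⟨C, 0, fun T hT γ hγ0 hγ1 u hu ν hν => ?_⟩
  have hT1 : (1 : ℝ) ≤ T := by exact_mod_cast hANT T hT
  obtain ⟨x, hx⟩ : ∃ x : ℝ, x = (T : ℝ) ^ (1 / 24 : ℝ) := ⟨_, rfl⟩
  have hx1 : 1 ≤ x := hx ▸ Real.one_le_rpow hT1 (by norm_num)
  have hTx : (T : ℝ) = x ^ 24 := by
    rw [hx, ← Real.rpow_natCast, ← Real.rpow_mul (by linarith)]
    norm_num
  have hpow : (T : ℝ) ^ (5 / 6 : ℝ) = x ^ 20 := by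
    rw [hx, ← Real.rpow_natCast, ← Real.rpow_mul (by linarith)]
    norm_num
  have hlogT : 0 ≤ Real.log T := Real.log_nonneg hT1
  -- The threshold solves `A * N * (2 * exp (s / 2 - B)) = 1 / T`.
  obtain ⟨B, hB⟩ : ∃ B : ℝ, B = s / 2 + Real.log (2 * (A * N)) + Real.log T := ⟨_, rfl⟩
  have hB0 : 0 ≤ B := by rw [hB]; positivity
  have hBb : U + B ≤ (U + (s / 2 + Real.log (2 * (A * N)) + 24)) * x ^ 2 := by
    have h1 : Real.log T ≤ 24 * x ^ 2 := by
      rw [hTx, Real.log_pow]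
      push_cast
      linarith [log_le_sq hx1]
    have h2 : U + (s / 2 + Real.log (2 * (A * N))) ≤
        (U + (s / 2 + Real.log (2 * (A * N)))) * x ^ 2 :=
      le_mul_of_one_le_right (by positivity) (one_le_pow₀ hx1)
    rw [hB]
    linarith
  refine ⟨{ω | Params.IsGood ⟨N, A, T, γ⟩ B ω}, Params.measurableSet_isGood _ _, ?_, fun ω hω => ?_⟩
  · have h := Params.measure_isGood_ge ⟨N, A, T, γ⟩ hν s B
    have hexp : (A : ℝ) * N * (2 * Real.exp (s / 2 - B)) = 1 / T := by
      have e : (s : ℝ) / 2 - B = -(Real.log (2 * (A * N)) + Real.log T) := by rw [hB]; ring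
      rw [e, ← Real.log_mul (by positivity) (by positivity), Real.exp_neg,
        Real.exp_log (by positivity)]
      field_simp
    have hP := hν.1
    have hP' := isProbabilityMeasure_exploreLaw (ν := ν) s
    refine ENNReal.ofReal_le_of_le_toReal ?_
    rw [← hexp]
    exact h
  · obtain ⟨hK, hle⟩ := hC ⟨N, A, T, γ⟩ rfl rfl hT hγ0 hγ1 u hu x hx1 hTx B hB0 hBb ω hω
    have hInt := (Params.integrable_externalRegret (P := ⟨N, A, T, γ⟩) hU hT hu hK s).1
    rw [hpow, pow_zero, mul_one]
    refine ⟨⟨hInt, hle⟩, fun heq => ?_⟩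
    simp only [Params.cumulativeRegret_eq_externalRegret (P := ⟨N, A, T, γ⟩) heq]
    exact ⟨hInt, hle⟩
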